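/- Let $d\ge 1$ be an integer, $s>0$, and let $f_s$ be the Bessel kernel on $\mathbb{R}^d$, i.e. the positive integrable function $$f_s(x)=\frac{1}{(4\pi)^{d/2}\Gamma(s/2)}\int_0^\infty e^{-u-|x|^2/(4u)}\,u^{(s-d)/2}\,\frac{du}{u},$$ whose Fourier transform is $\widehat f_s(\xi)=\int_{\mathbb{R}^d}e^{-ix\cdot\xi}f_s(x)\,dx=(1+|\xi|^2)^{-s/2}$. Set, with values in $[0,\infty]$, $$\Upsilon_\alpha(0)=(2\pi)^{-d}\int_{\mathbb{R}^d}\frac{\widehat f_s(\xi)\,d\xi}{|\xi|^{2(1-\alpha)}},\qquad \Upsilon(0)=\Upsilon_0(0),\qquad \mathcal{H}_\alpha(t)=\int_0^t dr\, r^{-2\alpha}\int_{\mathbb{R}^d}\widehat f_s(\xi)\,e^{-r|\xi|^2}\,d\xi .$$ **(1)** For every $\alpha\in\mathbb{R}$ with $s>d-2(1-\alpha)>0$, $$\Upsilon_\alpha(0)=\frac{\Gamma\left(\frac d2-1+\alpha\right)\Gamma\left(\frac{s-d}2+1-\alpha\right)}{2^d\pi^{d/2}\,\Gamma(d/2)\,\Gamma(s/2)}<\infty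 ;$$ in particular, if $s>d-2>0$, then $$\Upsilon(0)=\frac{\Gamma\left(\frac{2+s-d}2\right)}{2^{d-1}\pi^{d/2}(d-2)\Gamma(s/2)} .$$ **(2)** For every $\alpha>0$, $$\mathcal{H}_\alpha(t)<\infty\ \text{ for all } t>0\quad\Longleftrightarrow\quad \alpha<\frac12-\frac{(d-s)_+}{4}\ \text{ and }\ s>d-2,$$ where $a_+=\max(a,0)$. **(3)** For every $\alpha\in(0,1/2)$, as $t\to0^+$: (a) if $d-2<s<d$ and $\alpha<\frac12-\frac14(d-s)$, then $$\mathcal{H}_\alpha(t)=\frac{\pi^{d/2}\Gamma\left(\frac{d-s}2\right)}{\left(\frac{s-d}2+1-2\alpha\right)\Gamma(d/2)}\,t^{\frac{s-d}2+1-2\alpha}+\frac{\pi^{d/2}\Gamma\left(\frac{s-d}2\right)}{(1-2\alpha)\Gamma(s/2)}\,t^{1-2\alpha}+O\left(t^{\frac{s-d}2+2(1-\alpha)}\right);$$ (b) if $s=d$, then $$\mathcal{H}_\alpha(t)=\frac{\pi^{d/2}}{(1-2\alpha)\Gamma(d/2)}\,t^{1-2\alpha}\log\frac1t+\frac{\pi^{d/2}\left(1-(1-2\alpha)[\psi(d/2)+2\gamma]\right)}{(1-2\alpha)^2\,\Gamma(d/2)}\,t^{1-2\alpha}+O\left(t^{2(1-\alpha)}\log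 t\right);$$ (c) if $d<s<d+2$, then $$\mathcal{H}_\alpha(t)=\frac{\pi^{d/2}\Gamma\left(\frac{s-d}2\right)}{(1-2\alpha)\Gamma(s/2)}\,t^{1-2\alpha}+O\left(t^{\frac{s-d}2+1-2\alpha}\right);$$ (d) if $s=d+2$, then $$\mathcal{H}_\alpha(t)=\frac{\pi^{d/2}}{(1-2\alpha)\Gamma\left(\frac d2+1\right)}\,t^{1-2\alpha}+O\left(t^{2(1-\alpha)}\log t\right);$$ (e) if $s>d+2$, then $$\mathcal{H}_\alpha(t)=\frac{\pi^{d/2}\Gamma\left(\frac{s-d}2\right)}{(1-2\alpha)\Gamma(s/2)}\,t^{1-2\alpha}+O\left(t^{2(1-\alpha)}\right).$$ Here $\Gamma$ is the Gamma function, $\psi(x)=\frac{d}{dx}\log\Gamma(x)$ is the digamma function and $\gamma$ is Euler's constant. -/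

import Mathlib

open MeasureTheory Set Filter Topology Asymptotics

noncomputable section

namespace BesselNoise

/-- The Bessel kernel `f_s` on `ℝ^d`, `s > 0`, in its standard heat-semigroup form
`f_s(x) = 1 / ((4π)^{d/2} Γ(s/2)) ∫_0^∞ exp(-u - |x|² / (4u)) u^{(s-d)/2} du / u`,
the integrable function on `ℝ^d` with `∫ exp(-i x·ξ) f_s(x) dx = (1 + |ξ|²)^{-s/2}`.
The integral converges for every `x ≠ 0`. (When `s ≤ d` the kernel is infinite at the single
point `x = 0`; the value stored there is immaterial.) -/
def besselKernel (d : ℕ) (s : ℝ) (x : EuclideanSpace ℝ (Fin d)) : ℝ :=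
  ((4 * Real.pi) ^ ((d : ℝ) / 2) * Real.Gamma (s / 2))⁻¹ *
    ∫ u in Ioi (0 : ℝ), Real.exp (-u - ‖x‖ ^ 2 / (4 * u)) * u ^ ((s - d) / 2 - 1)

/-- The Fourier transform with the convention `𝓕φ(ξ) = ∫ exp(-i x·ξ) φ(x) dx`. -/
def fourierTransform {d : ℕ} (f : EuclideanSpace ℝ (Fin d) → ℝ)
    (ξ : EuclideanSpace ℝ (Fin d)) : ℂ :=
  ∫ x, Complex.exp (-(Complex.I * ((inner ℝ x ξ : ℝ) : ℂ))) * ((f x : ℝ) : ℂ)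

/-- The spectral measure `f̂(dξ) = f̂(ξ) dξ` of an integrable correlation function `f`
whose Fourier transform is real and nonnegative. -/
def spectralMeasure {d : ℕ} (f : EuclideanSpace ℝ (Fin d) → ℝ) :
    Measure (EuclideanSpace ℝ (Fin d)) :=
  volume.withDensity fun ξ => ENNReal.ofReal (fourierTransform f ξ).re

/-- `Υ_α(β) = (2π)^{-d} ∫ f̂(dξ) / (β + |ξ|²)^{1-α}`, as an extended nonnegative number,
for a spectral measure `μ = f̂`. -/
def upsilon {d : ℕ} (μ : Measure (EuclideanSpace ℝ (Fin d))) (α β : ℝ) : ENNReal :=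
  ENNReal.ofReal (((2 * Real.pi) ^ d)⁻¹) *
    ∫⁻ ξ, (ENNReal.ofReal (β + ‖ξ‖ ^ 2) ^ (1 - α))⁻¹ ∂μ

/-- `𝓗_α(t) = ∫_0^t dr r^{-2α} ∫ f̂(dξ) exp(-r|ξ|²)`, as an extended nonnegative number,
for a spectral measure `μ = f̂`. -/
def calH {d : ℕ} (μ : Measure (EuclideanSpace ℝ (Fin d))) (α t : ℝ) : ENNReal :=
  ∫⁻ r in Ioc (0 : ℝ) t, ENNReal.ofReal (r ^ (-(2 * α))) *
    ∫⁻ ξ, ENNReal.ofReal (Real.exp (-(r * ‖ξ‖ ^ 2))) ∂μ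

/-- The digamma function `ψ(x) = d/dx log Γ(x)` for `x > 0`. -/
def digamma (x : ℝ) : ℝ := deriv (fun y => Real.log (Real.Gamma y)) x

end BesselNoise

end

/-!
The Bessel kernel is a mixture of Gaussians, so Fubini gives its Fourier transform
`(1 + |ξ|²)^(-s/2)`. Integrating radially with `v = |ξ|²`, `Υ_α(0)` becomes a Beta integral, while
the inner integral of `𝓗_α` becomes a multiple of the confluent hypergeometric function
`K(r) = ∫ v^(d/2-1) (1+v)^(-s/2) e^(-rv) dv`. Finiteness follows from two-sided power bounds for `K`
near `0`, and the expansions of `𝓗_α` by integrating those of `K` against `r^(-2α)`.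

The expansions of `K` compare `∫ f(v) e^(-rv) dv` with `∫ f(v) dv`, where `f` is the Beta integrand
`v^(d/2-1) (1+v)^(-s/2)` if `s > d`. For `s < d` this is not integrable, and `f` is what remains of
it after subtracting `v^(d/2-1) v^(-s/2)`, whose Laplace transform is a power of `r`. For `s = d`
one subtracts `(1 - e^(-v)) / v`, whose Laplace transform is `log (1 + 1/r)`; the remaining integral
is the derivative of a Gamma quotient, which produces `ψ(d/2) + 2γ`.
-/

namespace BesselNoise

open Real

/-- `f` is integrable on `s` with integral `A`. Carrying integrability along with the value lets
the explicit integrals below be combined and swapped without side conditions. -/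
def HasIntegralOn {X : Type*} [MeasureSpace X] (f : X → ℝ) (s : Set X) (A : ℝ) : Prop :=
  IntegrableOn f s ∧ ∫ x in s, f x = A

namespace HasIntegralOn

variable {X Y : Type*} [MeasureSpace X] [MeasureSpace Y] {f g : X → ℝ} {s : Set X} {A B : ℝ}

theorem congr (h : HasIntegralOn f s A) (hs : MeasurableSet s) (hfg : ∀ x ∈ s, f x = g x)
    (hAB : A = B) : HasIntegralOn g s B :=
  ⟨h.1.congr_fun hfg hs, by rw [← hAB, ← h.2, setIntegral_congr_fun hs hfg]⟩

theorem congr_val (h : HasIntegralOn f s A) (hAB : A = B) : HasIntegralOn f s B := hAB ▸ h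

theorem add (hf : HasIntegralOn f s A) (hg : HasIntegralOn g s B) :
    HasIntegralOn (fun x => f x + g x) s (A + B) :=
  ⟨hf.1.add hg.1, by rw [integral_add hf.1 hg.1, hf.2, hg.2]⟩

theorem sub (hf : HasIntegralOn f s A) (hg : HasIntegralOn g s B) :
    HasIntegralOn (fun x => f x - g x) s (A - B) :=
  ⟨hf.1.sub hg.1, by rw [integral_sub hf.1 hg.1, hf.2, hg.2]⟩

theorem const_mul (hf : HasIntegralOn f s A) (k : ℝ) :
    HasIntegralOn (fun x => k * f x) s (k * A) :=
  ⟨hf.1.const_mul k, by rw [integral_const_mul, hf.2]⟩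

theorem mono (hf : HasIntegralOn f s A) (hg : HasIntegralOn g s B) (hs : MeasurableSet s)
    (h : ∀ x ∈ s, f x ≤ g x) : A ≤ B := by
  rw [← hf.2, ← hg.2]
  exact setIntegral_mono_on hf.1 hg.1 hs h

theorem lintegral_ofReal (hf : HasIntegralOn f s A) (hs : MeasurableSet s)
    (h0 : ∀ x ∈ s, 0 ≤ f x) : ∫⁻ x in s, ENNReal.ofReal (f x) = ENNReal.ofReal A := by
  rw [← hf.2, ofReal_integral_eq_lintegral_ofReal hf.1 (ae_restrict_of_forall_mem hs h0)]

theorem swap [SFinite (volume : Measure X)] [SFinite (volume : Measure Y)] {F : X → Y → ℝ}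
    {t : Set Y} {h : Y → ℝ} (hA : HasIntegralOn g s A)
    (hs : MeasurableSet s) (ht : MeasurableSet t) (hF : Measurable (Function.uncurry F))
    (h0 : ∀ x ∈ s, ∀ y ∈ t, 0 ≤ F x y) (hg : ∀ x ∈ s, HasIntegralOn (F x) t (g x))
    (hh : ∀ y ∈ t, HasIntegralOn (fun x => F x y) s (h y)) : HasIntegralOn h t A := by
  have hint : Integrable (Function.uncurry F) ((volume.restrict s).prod (volume.restrict t)) := by
    rw [integrable_prod_iff hF.aestronglyMeasurable]
    refine ⟨ae_restrict_of_forall_mem hs fun x hx => (hg x hx).1,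
      hA.1.congr (ae_restrict_of_forall_mem hs fun x hx => ?_)⟩
    rw [← (hg x hx).2]
    exact setIntegral_congr_fun ht fun y hy => (norm_of_nonneg (h0 x hx y hy)).symm
  have hinner : (fun y => ∫ x in s, F x y) =ᵐ[volume.restrict t] h :=
    ae_restrict_of_forall_mem ht fun y hy => (hh y hy).2
  refine ⟨hint.integral_prod_right.congr hinner, ?_⟩
  rw [← integral_congr_ae hinner, ← integral_integral_swap hint, ← hA.2]
  exact setIntegral_congr_fun hs fun x hx => (hg x hx).2

theorem of_hasDerivAt {f f' : ℝ → ℝ} {t : ℝ} (ht : 0 < t) (hc : ContinuousOn f (Icc 0 t))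
    (hd : ∀ x ∈ Ioo 0 t, HasDerivAt f (f' x) x) (h0 : ∀ x ∈ Ioo 0 t, 0 ≤ f' x) :
    HasIntegralOn f' (Ioc 0 t) (f t - f 0) := by
  have hint := intervalIntegral.integrableOn_deriv_of_nonneg hc hd h0
  refine ⟨hint, ?_⟩
  rw [← intervalIntegral.integral_of_le ht.le]
  exact intervalIntegral.integral_eq_sub_of_hasDerivAt_of_le ht.le hc hd
    ((intervalIntegrable_iff_integrableOn_Ioc_of_le ht.le).2 hint)

end HasIntegralOn

/-! ### Explicit integrals -/

theorem one_sub_exp_neg_nonneg {x : ℝ} (hx : 0 ≤ x) : 0 ≤ 1 - exp (-x) :=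
  sub_nonneg.2 (exp_le_one_iff.2 (neg_nonpos.2 hx))

theorem hasIntegralOn_rpow_mul_exp {a r : ℝ} (ha : 0 < a) (hr : 0 < r) :
    HasIntegralOn (fun v => v ^ (a - 1) * exp (-(r * v))) (Ioi 0) (r ^ (-a) * Gamma a) := by
  have h := integral_rpow_mul_exp_neg_mul_Ioi ha hr
  refine ⟨?_, by rw [h, one_div, inv_rpow hr.le, rpow_neg hr.le]⟩
  refine Integrable.of_integral_ne_zero ?_
  rw [h]
  have := Gamma_pos_of_pos ha
  positivity

theorem hasIntegralOn_rpow {p t : ℝ} (hp : -1 < p) (ht : 0 < t) :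
    HasIntegralOn (fun r => r ^ p) (Ioc 0 t) (t ^ (p + 1) / (p + 1)) := by
  refine ⟨(intervalIntegrable_iff_integrableOn_Ioc_of_le ht.le).1
    (intervalIntegral.intervalIntegrable_rpow' hp), ?_⟩
  rw [← intervalIntegral.integral_of_le ht.le, integral_rpow (Or.inl hp),
    zero_rpow (by linarith), sub_zero]

theorem continuousOn_rpow_mul_log {q : ℝ} (hq : 0 < q) :
    ContinuousOn (fun r => r ^ q * log r) (Ici 0) := by
  refine ((continuous_mul_log.comp (continuous_rpow_const hq.le)).div_const q).continuousOn.congr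
    fun r hr => ?_
  rcases (mem_Ici.1 hr).eq_or_lt with rfl | hr
  · simp [zero_rpow hq.ne']
  · simp only [Function.comp_apply, log_rpow hr]
    field_simp

theorem hasDerivAt_rpow_mul_log_sub {q x : ℝ} (hq : q ≠ 0) (hx : 0 < x) :
    HasDerivAt (fun r => r ^ q * log r / q - r ^ q / q ^ 2) (x ^ (q - 1) * log x) x := by
  have h1 := hasDerivAt_rpow_const (p := q) (Or.inl hx.ne')
  convert! ((h1.mul (hasDerivAt_log hx.ne')).div_const q).sub (h1.div_const (q ^ 2)) using 1
  rw [rpow_sub_one hx.ne']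
  field_simp
  ring

theorem hasIntegralOn_rpow_mul_log {p t : ℝ} (hp : -1 < p) (ht : 0 < t) (ht1 : t ≤ 1) :
    HasIntegralOn (fun r => r ^ p * log r) (Ioc 0 t)
      (t ^ (p + 1) * log t / (p + 1) - t ^ (p + 1) / (p + 1) ^ 2) := by
  have hp1 : 0 < p + 1 := by linarith
  have hcont : ContinuousOn (fun r => r ^ (p + 1) * log r / (p + 1) - r ^ (p + 1) / (p + 1) ^ 2)
      (Ici 0) :=
    ((continuousOn_rpow_mul_log hp1).div_const _).sub
      ((continuous_rpow_const hp1.le).div_const _).continuousOn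
  refine ((HasIntegralOn.of_hasDerivAt ht (hcont.mono Icc_subset_Ici_self).neg
    (fun x hx => (hasDerivAt_rpow_mul_log_sub hp1.ne' hx.1).neg) fun x hx => ?_).const_mul
    (-1)).congr measurableSet_Ioc (fun x _ => ?_) ?_
  · exact neg_nonneg.2 (mul_nonpos_of_nonneg_of_nonpos (rpow_nonneg hx.1.le _)
      (log_nonpos hx.1.le (hx.2.le.trans ht1)))
  · rw [add_sub_cancel_right, neg_one_mul, neg_neg]
  · simp [zero_rpow hp1.ne']

theorem hasIntegralOn_rpow_mul_add_rpow {a c θ : ℝ} (ha : 0 < a) (hac : a < c) (hθ : 0 < θ) :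
    HasIntegralOn (fun v => v ^ (a - 1) * (θ + v) ^ (-c)) (Ioi 0)
      (θ ^ (a - c) * (Gamma a * Gamma (c - a) / Gamma c)) := by
  have hc : 0 < c := ha.trans hac
  have : 0 < Gamma c := Gamma_pos_of_pos hc
  have hu := (hasIntegralOn_rpow_mul_exp (sub_pos.2 hac) hθ).const_mul (Gamma a)
  have hv : HasIntegralOn (fun v => v ^ (a - 1) * ((θ + v) ^ (-c) * Gamma c)) (Ioi 0)
      (Gamma a * (θ ^ (-(c - a)) * Gamma (c - a))) := by
    refine hu.swap (F := fun u v => u ^ (c - 1) * exp (-((θ + v) * u)) * v ^ (a - 1))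
      measurableSet_Ioi measurableSet_Ioi (by unfold Function.uncurry; fun_prop) ?_ ?_ ?_
    · intro u hu v hv
      have := mem_Ioi.1 hu
      have := mem_Ioi.1 hv
      positivity
    · intro u hu
      have hu := mem_Ioi.1 hu
      refine ((hasIntegralOn_rpow_mul_exp ha hu).const_mul
        (u ^ (c - 1) * exp (-(θ * u)))).congr measurableSet_Ioi (fun v _ => ?_) ?_
      · rw [show -((θ + v) * u) = -(θ * u) + -(u * v) by ring, exp_add]
        ring
      · rw [show c - a - 1 = (c - 1) + (-a) by ring, rpow_add hu]
        ring
    · intro v hv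
      have hv := mem_Ioi.1 hv
      exact ((hasIntegralOn_rpow_mul_exp hc (add_pos hθ hv)).const_mul (v ^ (a - 1))).congr
        measurableSet_Ioi (fun u _ => by ring) rfl
  refine (hv.const_mul (Gamma c)⁻¹).congr measurableSet_Ioi (fun v _ => ?_) ?_
  · field_simp
  · rw [neg_sub]
    field_simp

theorem hasIntegralOn_exp_neg_mul {v r : ℝ} (hv : 0 < v) (hr : 0 < r) :
    HasIntegralOn (fun θ => exp (-(θ * v))) (Ioc 0 r) ((1 - exp (-(r * v))) / v) := by
  refine (HasIntegralOn.of_hasDerivAt (f := fun θ => -exp (-(θ * v)) / v) hr (by fun_prop)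
    (fun x _ => ?_) fun x _ => by positivity).congr_val ?_
  · have h : HasDerivAt (fun θ : ℝ => -(θ * v)) (-v) x := by
      simpa using ((hasDerivAt_id x).mul_const v).fun_neg
    convert! h.exp.neg.div_const v using 1
    field_simp
  · rw [zero_mul, neg_zero, exp_zero]
    ring

theorem hasIntegralOn_rpow_mul_one_sub_exp {ε r : ℝ} (h0 : 0 < ε) (h1 : ε < 1) (hr : 0 < r) :
    HasIntegralOn (fun v => v ^ (-1 - ε) * (1 - exp (-(r * v)))) (Ioi 0)
      (Gamma (1 - ε) * (r ^ ε / ε)) := by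
  have hθ := (hasIntegralOn_rpow (p := ε - 1) (by linarith) hr).const_mul (Gamma (1 - ε))
  refine (hθ.swap (F := fun θ v => v ^ (-ε) * exp (-(θ * v))) (t := Ioi 0)
    (h := fun v => v ^ (-ε) * ((1 - exp (-(r * v))) / v))
    measurableSet_Ioc measurableSet_Ioi (by unfold Function.uncurry; fun_prop) ?_ ?_ ?_).congr
    measurableSet_Ioi (fun v hv => ?_) (by rw [sub_add_cancel])
  · intro θ _ v hv
    have := mem_Ioi.1 hv
    positivity
  · intro θ hθ
    refine (hasIntegralOn_rpow_mul_exp (sub_pos.2 h1) hθ.1).congr measurableSet_Ioi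
      (fun v _ => by rw [sub_sub_cancel_left]) (by rw [neg_sub, mul_comm])
  · exact fun v hv => (hasIntegralOn_exp_neg_mul hv hr).const_mul _
  · rw [show -1 - ε = -ε + -1 by ring, rpow_add hv, rpow_neg_one]
    ring

theorem hasIntegralOn_frullani {r : ℝ} (hr : 0 < r) :
    HasIntegralOn (fun v => (1 - exp (-v)) / v * exp (-(r * v))) (Ioi 0)
      (log (1 + r) - log r) := by
  have hθ : HasIntegralOn (fun θ => (θ + r)⁻¹) (Ioc 0 1) (log (1 + r) - log r) := by
    have hne : ∀ x, 0 ≤ x → x + r ≠ 0 := fun x hx => (add_pos_of_nonneg_of_pos hx hr).ne'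
    refine (HasIntegralOn.of_hasDerivAt (f := fun θ => log (θ + r)) one_pos ?_ ?_ ?_).congr_val
      (by rw [zero_add])
    · exact (by fun_prop : Continuous fun θ => θ + r).continuousOn.log fun x hx => hne x hx.1
    · intro x hx
      simpa using ((hasDerivAt_id x).add_const r).log (hne x hx.1.le)
    · intro x hx
      have := hx.1
      positivity
  refine hθ.swap (F := fun θ v => exp (-(θ * v)) * exp (-(r * v)))
    measurableSet_Ioc measurableSet_Ioi (by unfold Function.uncurry; fun_prop)
    (fun x _ v _ => by positivity) ?_ ?_
  · intro θ hθ
    refine (hasIntegralOn_rpow_mul_exp one_pos (add_pos hθ.1 hr)).congr measurableSet_Ioi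
      (fun v _ => ?_) (by rw [rpow_neg_one, Gamma_one, mul_one])
    rw [sub_self, rpow_zero, one_mul, ← exp_add]
    ring_nf
  · intro v hv
    refine ((hasIntegralOn_exp_neg_mul hv one_pos).const_mul (exp (-(r * v)))).congr
      measurableSet_Ioc (fun θ _ => mul_comm _ _) (by rw [one_mul, mul_comm])

theorem hasIntegralOn_log_one_add_sub_log {r : ℝ} (hr : 0 < r) :
    HasIntegralOn (fun θ => log (1 + θ) - log θ) (Ioc 0 r)
      ((1 + r) * log (1 + r) - r * log r) := by
  refine (HasIntegralOn.of_hasDerivAt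
    (f := fun θ => (1 + θ) * log (1 + θ) - θ * log θ) hr ?_ ?_ ?_).congr_val (by simp)
  · have h := continuous_mul_log
    exact ((h.comp (continuous_const.add continuous_id)).sub h).continuousOn
  · intro x hx
    have h1 := (hasDerivAt_mul_log (x := 1 + x) (by linarith [hx.1])).comp_const_add 1 x
    convert! h1.sub (hasDerivAt_mul_log hx.1.ne') using 1
    ring
  · exact fun x hx => sub_nonneg.2 (log_le_log hx.1 (by linarith))

theorem hasIntegralOn_one_sub_exp_div_sq_mul_one_sub_exp {r : ℝ} (hr : 0 < r) :
    HasIntegralOn (fun v => (1 - exp (-v)) / v ^ 2 * (1 - exp (-(r * v)))) (Ioi 0)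
      ((1 + r) * log (1 + r) - r * log r) := by
  refine (hasIntegralOn_log_one_add_sub_log hr).swap
    (F := fun θ v => (1 - exp (-v)) / v * exp (-(θ * v)))
    measurableSet_Ioc measurableSet_Ioi (by unfold Function.uncurry; fun_prop) ?_
    (fun θ hθ => hasIntegralOn_frullani hθ.1) fun v hv => ?_
  · intro θ _ v hv
    have hv := mem_Ioi.1 hv
    have := one_sub_exp_neg_nonneg hv.le
    positivity
  · refine ((hasIntegralOn_exp_neg_mul hv hr).const_mul ((1 - exp (-v)) / v)).congr_val ?_
    ring

theorem hasIntegralOn_mul_add_rpow {c v : ℝ} (hc : 0 ≤ c) (hv : 0 < v) :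
    HasIntegralOn (fun θ => c * (θ + v) ^ (-(c + 1))) (Ioc 0 1) (v ^ (-c) - (1 + v) ^ (-c)) := by
  have hpos : ∀ x, 0 ≤ x → 0 < x + v := fun x hx => add_pos_of_nonneg_of_pos hx hv
  refine (HasIntegralOn.of_hasDerivAt (f := fun θ => -(θ + v) ^ (-c)) one_pos ?_ ?_ ?_).congr_val
    (by rw [zero_add]; ring)
  · exact ((by fun_prop : Continuous fun θ => θ + v).continuousOn.rpow_const
      fun x hx => Or.inl (hpos x hx.1).ne').neg
  · intro x hx
    convert! (((hasDerivAt_id x).add_const v).rpow_const (p := -c)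
      (Or.inl (hpos x hx.1.le).ne')).neg using 1
    rw [neg_add']
    simp only [id]
    ring
  · intro x hx
    have := hpos x hx.1.le
    positivity

/-- The Beta integral `∫ v^(a-1) (1+v)^(-c)` diverges for `c < a`; subtracting `v^(-c)` gives its
analytic continuation. -/
theorem hasIntegralOn_rpow_mul_sub {a c : ℝ} (hc : 0 < c) (h1 : a - 1 < c) (h2 : c < a) :
    HasIntegralOn (fun v => v ^ (a - 1) * (v ^ (-c) - (1 + v) ^ (-c))) (Ioi 0)
      (-(Gamma a * Gamma (c - a) / Gamma c)) := by
  have ha : 0 < a := hc.trans h2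
  have hθ := ((hasIntegralOn_rpow (p := a - c - 1) (by linarith) one_pos).const_mul
    (c * (Gamma a * Gamma (c + 1 - a) / Gamma (c + 1)))).congr_val
      (B := -(Gamma a * Gamma (c - a) / Gamma c)) (by
        rw [show c + 1 - a = (c - a) + 1 by ring, Gamma_add_one (by linarith),
          Gamma_add_one hc.ne', one_rpow, sub_add_cancel]
        have := Gamma_pos_of_pos hc
        have : a - c ≠ 0 := by linarith
        field_simp
        ring)
  refine hθ.swap (F := fun θ v => v ^ (a - 1) * (c * (θ + v) ^ (-(c + 1))))
    measurableSet_Ioc measurableSet_Ioi (by unfold Function.uncurry; fun_prop) ?_ ?_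
    fun v hv => (hasIntegralOn_mul_add_rpow hc.le hv).const_mul _
  · intro θ hθ v hv
    have := mem_Ioi.1 hv
    have := hθ.1
    positivity
  · intro θ hθ
    refine ((hasIntegralOn_rpow_mul_add_rpow (c := c + 1) ha (by linarith) hθ.1).const_mul c).congr
      measurableSet_Ioi (fun v _ => by ring) ?_
    rw [show a - (c + 1) = a - c - 1 by ring]
    ring

/-! ### The critical Beta integrand -/

/-- The difference between the critical Beta integrand `v^(a-1) (1+v)^(-a)`, whose integral
diverges logarithmically at infinity, and the integrand `(1 - e^(-v)) / v`, which diverges in the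
same way and whose Laplace transform is the elementary function `log (1 + 1/r)`. -/
noncomputable def logKernel (a v : ℝ) : ℝ := v ^ (a - 1) * (1 + v) ^ (-a) - (1 - exp (-v)) / v

theorem measurable_logKernel (a : ℝ) : Measurable (logKernel a) := by
  unfold logKernel
  fun_prop

theorem inv_one_add_le_one_sub_exp_div {v : ℝ} (hv : 0 < v) :
    (1 + v)⁻¹ ≤ (1 - exp (-v)) / v := by
  have hexp : exp (-v) ≤ (1 + v)⁻¹ := by
    rw [exp_neg]
    exact inv_anti₀ (by linarith) (by linarith [add_one_le_exp v])
  calc (1 + v)⁻¹ = (1 - (1 + v)⁻¹) / v := by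
        field_simp
        ring
    _ ≤ (1 - exp (-v)) / v := by gcongr

theorem one_sub_exp_div_sub_inv_le {v : ℝ} (hv : 0 < v) :
    (1 - exp (-v)) / v - (1 + v)⁻¹ ≤ 2 * (1 + v) ^ (-2 : ℝ) := by
  have hnum : (1 - (1 + v) * exp (-v)) * (1 + v) ≤ 2 * v := by
    have hexp := add_one_le_exp (-v)
    have hpos := exp_pos (-v)
    rcases le_total v 1 with h | h
    · nlinarith [mul_le_mul_of_nonneg_left hexp (sq_nonneg (1 + v)),
        mul_nonneg hv.le (mul_nonneg (sub_nonneg.2 h) (show 0 ≤ 2 + v by linarith))]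
    · nlinarith [mul_nonneg (sq_nonneg (1 + v)) hpos.le]
  calc (1 - exp (-v)) / v - (1 + v)⁻¹
      = (1 - (1 + v) * exp (-v)) * (1 + v) / (v * (1 + v) ^ 2) := by
        field_simp
        ring
    _ ≤ 2 * v / (v * (1 + v) ^ 2) := by gcongr
    _ = 2 * (1 + v) ^ (-2 : ℝ) := by
        rw [rpow_neg (by linarith), rpow_two]
        field_simp

theorem abs_rpow_sub_one_le {p x : ℝ} (hp : -1 ≤ p) (h0 : 0 < x) (h1 : x ≤ 1) :
    |x ^ p - 1| ≤ (|p| + 1) * ((1 - x) * (1 + x ^ p)) := by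
  have hxp : 0 < x ^ p := rpow_pos_of_pos h0 p
  have hmul : x ^ (p + 1) = x ^ p * x := rpow_add_one h0.ne' p
  have hx1 : 0 ≤ 1 - x := sub_nonneg.2 h1
  have hp0 := abs_nonneg p
  have hupper : x ^ p - 1 ≤ (1 - x) * x ^ p := by
    linarith [rpow_le_one h0.le h1 (show 0 ≤ p + 1 by linarith)]
  have hlower : 1 - x ^ p ≤ (|p| + 1) * (1 - x) := by
    rcases le_total 0 p with hp' | hp'
    · have bernoulli := one_add_mul_self_le_rpow_one_add (s := x - 1) (by linarith)
        (show 1 ≤ p + 1 by linarith)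
      rw [add_sub_cancel] at bernoulli
      rw [abs_of_nonneg hp']
      nlinarith
    · have := one_le_rpow_of_pos_of_le_one_of_nonpos h0 h1 hp'
      nlinarith
  rw [abs_le]
  constructor
  · nlinarith [mul_nonneg hx1 hxp.le]
  · nlinarith [mul_nonneg hx1 hxp.le]

theorem rpow_mul_one_add_rpow_neg {p v : ℝ} (hv : 0 < v) :
    v ^ p * (1 + v) ^ (-p) = (v / (1 + v)) ^ p := by
  rw [div_rpow hv.le (by linarith), rpow_neg (by linarith), div_eq_mul_inv]

theorem abs_rpow_mul_one_add_rpow_sub_inv_le {a v : ℝ} (ha : 0 ≤ a) (hv : 0 < v) :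
    |v ^ (a - 1) * (1 + v) ^ (-a) - (1 + v)⁻¹| ≤
      (|a - 1| + 1) * (v ^ (a - 1) * (1 + v) ^ (-(a + 1)) + (1 + v) ^ (-2 : ℝ)) := by
  have hv1 : 0 < 1 + v := by linarith
  have hx := abs_rpow_sub_one_le (p := a - 1) (x := v / (1 + v)) (by linarith) (by positivity)
    ((div_le_one hv1).2 (by linarith))
  rw [← rpow_mul_one_add_rpow_neg hv, show 1 - v / (1 + v) = (1 + v)⁻¹ by field_simp; ring] at hx
  have e1 : (1 + v) ^ (-a) = (1 + v) ^ (-(a - 1)) * (1 + v)⁻¹ := by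
    rw [← rpow_neg_one, ← rpow_add hv1]
    ring_nf
  have e2 : (1 + v) ^ (-(a + 1)) = (1 + v) ^ (-(a - 1)) * (1 + v)⁻¹ * (1 + v)⁻¹ := by
    rw [← e1, ← rpow_neg_one, ← rpow_add hv1, neg_add]
  have e3 : (1 + v) ^ (-2 : ℝ) = (1 + v)⁻¹ * (1 + v)⁻¹ := by
    rw [rpow_neg hv1.le, rpow_two, sq, mul_inv]
  calc |v ^ (a - 1) * (1 + v) ^ (-a) - (1 + v)⁻¹|
      = |v ^ (a - 1) * (1 + v) ^ (-(a - 1)) - 1| * (1 + v)⁻¹ := by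
        rw [e1, ← abs_of_pos (inv_pos.2 hv1), ← abs_mul, abs_of_pos (inv_pos.2 hv1)]
        ring_nf
    _ ≤ _ := mul_le_mul_of_nonneg_right hx (inv_pos.2 hv1).le
    _ = _ := by
        rw [e2, e3]
        ring

theorem abs_logKernel_le {a v : ℝ} (ha : 0 ≤ a) (hv : 0 < v) :
    |logKernel a v| ≤ (|a - 1| + 3) * (v ^ (a - 1) * (1 + v) ^ (-(a + 1)) +
      (1 + v) ^ (-2 : ℝ)) := by
  have h1 := abs_rpow_mul_one_add_rpow_sub_inv_le ha hv
  have h2 : |(1 + v)⁻¹ - (1 - exp (-v)) / v| ≤ 2 * (1 + v) ^ (-2 : ℝ) := by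
    rw [abs_sub_comm, abs_of_nonneg (sub_nonneg.2 (inv_one_add_le_one_sub_exp_div hv))]
    exact one_sub_exp_div_sub_inv_le hv
  have h3 : 0 ≤ v ^ (a - 1) * (1 + v) ^ (-(a + 1)) := by positivity
  rw [logKernel, ← sub_add_sub_cancel _ (1 + v)⁻¹]
  linarith [abs_add_le (v ^ (a - 1) * (1 + v) ^ (-a) - (1 + v)⁻¹)
    ((1 + v)⁻¹ - (1 - exp (-v)) / v)]

theorem rpow_mul_one_add_rpow_le {b v : ℝ} (hb : 0 ≤ b) (hv : 0 < v) :
    v ^ (b - 1) * (1 + v) ^ (-(b + 1)) ≤ (1 - exp (-v)) / v ^ 2 := by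
  have hv1 : 0 < 1 + v := by linarith
  have hle : (v / (1 + v)) ^ b ≤ 1 :=
    rpow_le_one (by positivity) ((div_le_one hv1).2 (by linarith)) hb
  calc v ^ (b - 1) * (1 + v) ^ (-(b + 1)) = (v / (1 + v)) ^ b * ((1 + v)⁻¹ / v) := by
        rw [← rpow_mul_one_add_rpow_neg hv, rpow_sub_one hv.ne', neg_add, rpow_add hv1,
          rpow_neg_one]
        ring
    _ ≤ 1 * ((1 - exp (-v)) / v / v) := by
        gcongr
        exact inv_one_add_le_one_sub_exp_div hv
    _ = (1 - exp (-v)) / v ^ 2 := by ring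

theorem abs_logKernel_le_one_sub_exp_div_sq {a v : ℝ} (ha : 0 ≤ a) (hv : 0 < v) :
    |logKernel a v| ≤ 2 * (|a - 1| + 3) * ((1 - exp (-v)) / v ^ 2) := by
  have h1 := rpow_mul_one_add_rpow_le ha hv
  have h2 := rpow_mul_one_add_rpow_le zero_le_one hv
  rw [sub_self, rpow_zero, one_mul, one_add_one_eq_two] at h2
  calc |logKernel a v| ≤ _ := abs_logKernel_le ha hv
    _ ≤ (|a - 1| + 3) * ((1 - exp (-v)) / v ^ 2 + (1 - exp (-v)) / v ^ 2) := by gcongr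
    _ = _ := by ring

theorem hasIntegralOn_rpow_neg_mul_logKernel {a ε : ℝ} (h0 : 0 < ε) (h1 : ε < 1) (ha : ε < a) :
    HasIntegralOn (fun v => v ^ (-ε) * logKernel a v) (Ioi 0)
      (ε⁻¹ * (Gamma (a - ε) * Gamma (1 + ε) / Gamma a - Gamma (1 - ε))) := by
  refine ((hasIntegralOn_rpow_mul_add_rpow (sub_pos.2 ha) (sub_lt_self a h0) one_pos).sub
    (hasIntegralOn_rpow_mul_one_sub_exp h0 h1 one_pos)).congr measurableSet_Ioi (fun v hv => ?_) ?_
  · rw [logKernel, show a - ε - 1 = -ε + (a - 1) by ring, rpow_add hv,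
      show -1 - ε = -ε + -1 by ring, rpow_add hv, rpow_neg_one, one_mul]
    ring
  · rw [one_rpow, one_rpow, add_comm 1 ε, Gamma_add_one h0.ne', sub_sub_cancel]
    field_simp

/-- An integrable majorant of `v ^ (-ε) * logKernel a v`, uniform in `0 ≤ ε ≤ δ`. -/
noncomputable def logKernelMajorant (a δ v : ℝ) : ℝ :=
  (1 + v ^ (-δ)) * ((|a - 1| + 3) * (v ^ (a - 1) * (1 + v) ^ (-(a + 1)) + (1 + v) ^ (-2 : ℝ)))

theorem integrableOn_logKernelMajorant {a δ : ℝ} (h0 : 0 < δ) (h1 : δ < 1) (ha : δ < a) :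
    IntegrableOn (logKernelMajorant a δ) (Ioi 0) := by
  have hbeta : ∀ b, δ < b → IntegrableOn
      (fun v : ℝ => (1 + v ^ (-δ)) * (v ^ (b - 1) * (1 + v) ^ (-(b + 1)))) (Ioi 0) := by
    intro b hb
    refine ((hasIntegralOn_rpow_mul_add_rpow (h0.trans hb) (lt_add_one b) one_pos).add
      (hasIntegralOn_rpow_mul_add_rpow (c := b + 1) (sub_pos.2 hb) (by linarith)
        one_pos)).1.congr_fun (fun v hv => ?_) measurableSet_Ioi
    simp only [show b - δ - 1 = -δ + (b - 1) by ring, rpow_add (mem_Ioi.1 hv)]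
    ring
  refine IntegrableOn.congr_fun (((hbeta a ha).add (hbeta 1 h1)).const_mul (|a - 1| + 3))
    (fun v _ => ?_) measurableSet_Ioi
  simp only [Pi.add_apply, logKernelMajorant, sub_self, rpow_zero, one_mul, one_add_one_eq_two]
  ring

theorem norm_rpow_neg_mul_logKernel_le {a δ ε v : ℝ} (ha : 0 ≤ a) (h0 : 0 ≤ ε) (hε : ε ≤ δ)
    (hv : 0 < v) : ‖v ^ (-ε) * logKernel a v‖ ≤ logKernelMajorant a δ v := by
  have hrpow : v ^ (-ε) ≤ 1 + v ^ (-δ) := by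
    rcases le_total 1 v with h | h
    · linarith [rpow_le_one_of_one_le_of_nonpos h (neg_nonpos.2 h0), rpow_pos_of_pos hv (-δ)]
    · linarith [rpow_le_rpow_of_exponent_ge hv h (neg_le_neg hε)]
  rw [norm_mul, norm_of_nonneg (rpow_nonneg hv.le _)]
  exact mul_le_mul hrpow (abs_logKernel_le ha hv) (norm_nonneg _) (by positivity)

theorem integrableOn_logKernel {a : ℝ} (ha : 0 < a) : IntegrableOn (logKernel a) (Ioi 0) := by
  obtain ⟨δ, h0, hδ⟩ := exists_between (lt_min ha one_pos)
  obtain ⟨hδa, hδ1⟩ := lt_min_iff.1 hδ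
  refine (integrableOn_logKernelMajorant h0 hδ1 hδa).mono'
    (measurable_logKernel a).aestronglyMeasurable
    (ae_restrict_of_forall_mem measurableSet_Ioi fun v hv => ?_)
  simpa using norm_rpow_neg_mul_logKernel_le ha.le le_rfl h0.le hv

theorem tendsto_integral_rpow_neg_mul_logKernel {a : ℝ} (ha : 0 < a) :
    Tendsto (fun ε : ℝ => ∫ v in Ioi 0, v ^ (-ε) * logKernel a v) (𝓝[>] 0)
      (𝓝 (∫ v in Ioi 0, logKernel a v)) := by
  obtain ⟨δ, h0, hδ⟩ := exists_between (lt_min ha one_pos)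
  obtain ⟨hδa, hδ1⟩ := lt_min_iff.1 hδ
  have hmeas := measurable_logKernel a
  refine tendsto_integral_filter_of_dominated_convergence _
    (.of_forall fun ε => (by fun_prop : Measurable _).aestronglyMeasurable) ?_
    (integrableOn_logKernelMajorant h0 hδ1 hδa) ?_
  · filter_upwards [Ioc_mem_nhdsGT h0] with ε hε
    exact ae_restrict_of_forall_mem measurableSet_Ioi fun v hv =>
      norm_rpow_neg_mul_logKernel_le ha.le hε.1.le hε.2 hv
  · refine ae_restrict_of_forall_mem measurableSet_Ioi fun v hv => ?_
    have hcont : Continuous fun ε : ℝ => v ^ (-ε) * logKernel a v :=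
      ((continuous_const_rpow (mem_Ioi.1 hv).ne').comp continuous_neg).mul continuous_const
    simpa using (hcont.tendsto 0).mono_left nhdsWithin_le_nhds

theorem hasDerivAt_Gamma {a : ℝ} (ha : 0 < a) : HasDerivAt Gamma (digamma a * Gamma a) a := by
  have hd : DifferentiableAt ℝ Gamma a :=
    differentiableAt_Gamma fun m => (by linarith [m.cast_nonneg (α := ℝ)] : -(m : ℝ) < a).ne'
  have hG := (Gamma_pos_of_pos ha).ne'
  convert! hd.hasDerivAt using 1
  rw [digamma, (hd.hasDerivAt.log hG).deriv, div_mul_cancel₀ _ hG]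

theorem hasDerivAt_Gamma_mul_Gamma_div_sub {a : ℝ} (ha : 0 < a) :
    HasDerivAt (fun ε => Gamma (a - ε) * Gamma (1 + ε) / Gamma a - Gamma (1 - ε))
      (-digamma a - 2 * eulerMascheroniConstant) 0 := by
  have ha' : HasDerivAt (fun ε => Gamma (a - ε)) (-(digamma a * Gamma a)) 0 :=
    HasDerivAt.comp_const_sub a 0 (by simpa using hasDerivAt_Gamma ha)
  have hadd : HasDerivAt (fun ε => Gamma (1 + ε)) (-eulerMascheroniConstant) 0 :=
    HasDerivAt.comp_const_add 1 0 (by simpa using hasDerivAt_Gamma_one)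
  have hsub : HasDerivAt (fun ε => Gamma (1 - ε)) (- -eulerMascheroniConstant) 0 :=
    HasDerivAt.comp_const_sub 1 0 (by simpa using hasDerivAt_Gamma_one)
  convert! ((ha'.mul hadd).div_const (Gamma a)).sub hsub using 1
  have := Gamma_pos_of_pos ha
  rw [add_zero, sub_zero, Gamma_one]
  field_simp
  ring

theorem hasIntegralOn_logKernel {a : ℝ} (ha : 0 < a) :
    HasIntegralOn (logKernel a) (Ioi 0) (-digamma a - 2 * eulerMascheroniConstant) := by
  refine ⟨integrableOn_logKernel ha, ?_⟩
  have hslope := (hasDerivAt_iff_tendsto_slope.1 (hasDerivAt_Gamma_mul_Gamma_div_sub ha)).mono_left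
    (nhdsWithin_mono 0 fun x (hx : 0 < x) => hx.ne')
  refine tendsto_nhds_unique (tendsto_integral_rpow_neg_mul_logKernel ha) (hslope.congr' ?_)
  filter_upwards [Ioo_mem_nhdsGT (lt_min ha one_pos)] with ε hε
  obtain ⟨hεa, hε1⟩ := lt_min_iff.1 hε.2
  rw [(hasIntegralOn_rpow_neg_mul_logKernel hε.1 hε1 hεa).2, slope_def_field]
  simp [(Gamma_pos_of_pos ha).ne', div_eq_inv_mul]

/-! ### Abelian estimates for Laplace transforms -/

theorem integrableOn_mul_exp_neg_mul {f : ℝ → ℝ} {r : ℝ} (hf : IntegrableOn f (Ioi 0))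
    (hr : 0 ≤ r) : IntegrableOn (fun v => f v * exp (-(r * v))) (Ioi 0) := by
  have hexp : Measurable fun v => exp (-(r * v)) := by fun_prop
  refine Integrable.mul_bdd (c := 1) hf hexp.aestronglyMeasurable
    (ae_restrict_of_forall_mem measurableSet_Ioi fun v hv => ?_)
  rw [norm_of_nonneg (exp_pos _).le, exp_le_one_iff]
  exact neg_nonpos.2 (mul_nonneg hr (mem_Ioi.1 hv).le)

theorem laplace_sub_isBigO {f E : ℝ → ℝ} {G : ℝ → ℝ → ℝ} {A C : ℝ}
    (hf : HasIntegralOn f (Ioi 0) A) (hG : ∀ r, 0 < r → HasIntegralOn (G r) (Ioi 0) (E r))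
    (hle : ∀ r v, 0 < r → 0 < v → |f v| * (1 - exp (-(r * v))) ≤ C * G r v) :
    (fun r => (∫ v in Ioi 0, f v * exp (-(r * v))) - A) =O[𝓝[>] 0] E := by
  refine IsBigO.of_bound |C| ?_
  filter_upwards [self_mem_nhdsWithin] with r hr
  have hr := mem_Ioi.1 hr
  rw [← hf.2, ← integral_sub (integrableOn_mul_exp_neg_mul hf.1 hr.le) hf.1, ← norm_eq_abs,
    ← norm_mul, ← ((hG r hr).const_mul C).2]
  refine (norm_integral_le_of_norm_le ((hG r hr).const_mul C).1
    (ae_restrict_of_forall_mem measurableSet_Ioi fun v hv => ?_)).trans (le_norm_self _)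
  refine le_trans (le_of_eq ?_) (hle r v hr hv)
  rw [← mul_sub_one, norm_mul, norm_eq_abs, norm_sub_rev,
    norm_of_nonneg (one_sub_exp_neg_nonneg (mul_pos hr hv).le)]

theorem laplace_sub_isBigO_rpow {f : ℝ → ℝ} {A C ε : ℝ} (hf : HasIntegralOn f (Ioi 0) A)
    (h0 : 0 < ε) (h1 : ε < 1) (hle : ∀ v, 0 < v → |f v| ≤ C * v ^ (-1 - ε)) :
    (fun r => (∫ v in Ioi 0, f v * exp (-(r * v))) - A) =O[𝓝[>] 0] fun r => r ^ ε := by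
  have h := laplace_sub_isBigO (C := C) hf
    (fun r hr => hasIntegralOn_rpow_mul_one_sub_exp h0 h1 hr) fun r v hr hv => ?_
  · refine h.trans ?_
    simp only [div_eq_inv_mul]
    exact ((isBigO_refl _ _).const_mul_left _).const_mul_left _
  · rw [← mul_assoc]
    exact mul_le_mul_of_nonneg_right (hle v hv) (one_sub_exp_neg_nonneg (mul_pos hr hv).le)

theorem laplace_sub_isBigO_id {f : ℝ → ℝ} {A : ℝ} (hf : HasIntegralOn f (Ioi 0) A)
    (hf' : IntegrableOn (fun v => v * f v) (Ioi 0)) :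
    (fun r => (∫ v in Ioi 0, f v * exp (-(r * v))) - A) =O[𝓝[>] 0] fun r => r := by
  have hnorm : HasIntegralOn (fun v => ‖v * f v‖) (Ioi 0) (∫ v in Ioi (0 : ℝ), ‖v * f v‖) :=
    ⟨hf'.norm, rfl⟩
  have h := laplace_sub_isBigO (C := 1) hf (fun r _ => hnorm.const_mul r) fun r v _ hv => ?_
  · refine h.trans ?_
    simpa only [mul_comm] using (isBigO_refl (fun r : ℝ => r) (𝓝[>] 0)).const_mul_left
      (∫ v in Ioi 0, ‖v * f v‖)
  · rw [norm_mul, norm_of_nonneg hv.le, norm_eq_abs, one_mul]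
    calc |f v| * (1 - exp (-(r * v))) ≤ |f v| * (r * v) := by
          gcongr
          linarith [one_sub_le_exp_neg (r * v)]
      _ = r * (v * |f v|) := by ring

theorem one_isBigO_log : (fun _ : ℝ => (1 : ℝ)) =O[𝓝[>] 0] log :=
  (isLittleO_const_left.2
    (Or.inr (tendsto_abs_atBot_atTop.comp tendsto_log_nhdsGT_zero))).isBigO

theorem id_isBigO_mul_log : (fun r : ℝ => r) =O[𝓝[>] 0] fun r => r * log r := by
  simpa only [mul_one] using (isBigO_refl (fun r : ℝ => r) (𝓝[>] 0)).mul one_isBigO_log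

theorem log_one_add_isBigO_mul_log :
    (fun r : ℝ => log (1 + r)) =O[𝓝[>] 0] fun r => r * log r := by
  refine IsBigO.trans (IsBigO.of_bound 1 ?_) id_isBigO_mul_log
  filter_upwards [self_mem_nhdsWithin] with r hr
  have hr := mem_Ioi.1 hr
  rw [norm_of_nonneg (log_nonneg (by linarith)), norm_of_nonneg hr.le, one_mul]
  linarith [log_le_sub_one_of_pos (show 0 < 1 + r by linarith)]

theorem laplace_sub_isBigO_mul_log {f : ℝ → ℝ} {A C : ℝ} (hf : HasIntegralOn f (Ioi 0) A)
    (hle : ∀ v, 0 < v → |f v| ≤ C * ((1 - exp (-v)) / v ^ 2)) :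
    (fun r => (∫ v in Ioi 0, f v * exp (-(r * v))) - A) =O[𝓝[>] 0] fun r => r * log r := by
  have h := laplace_sub_isBigO (C := C) hf
    (fun r hr => hasIntegralOn_one_sub_exp_div_sq_mul_one_sub_exp hr) fun r v hr hv => ?_
  · have hbdd : (fun r : ℝ => 1 + r) =O[𝓝[>] 0] fun _ => (1 : ℝ) :=
      ((by fun_prop : Continuous fun r : ℝ => 1 + r).tendsto 0).isBigO_one ℝ |>.mono
        nhdsWithin_le_nhds
    have hlog := hbdd.mul log_one_add_isBigO_mul_log
    simp only [one_mul] at hlog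
    exact h.trans (hlog.sub (isBigO_refl _ _))
  · rw [← mul_assoc]
    exact mul_le_mul_of_nonneg_right (hle v hv) (one_sub_exp_neg_nonneg (mul_pos hr hv).le)

/-! ### The confluent hypergeometric function -/

/-- The confluent hypergeometric integral `Γ(a) U(a, a - c + 1, r)`, with `U` Kummer's function of
the second kind. -/
noncomputable def kummer (a c r : ℝ) : ℝ :=
  ∫ v in Ioi (0 : ℝ), v ^ (a - 1) * (1 + v) ^ (-c) * exp (-(r * v))

theorem one_add_rpow_neg_le {c v : ℝ} (hc : 0 ≤ c) (hv : 0 < v) : (1 + v) ^ (-c) ≤ v ^ (-c) :=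
  rpow_le_rpow_of_nonpos hv (by linarith) (by linarith)

theorem hasIntegralOn_kummer {a c r : ℝ} (ha : 0 < a) (hc : 0 ≤ c) (hr : 0 < r) :
    HasIntegralOn (fun v => v ^ (a - 1) * (1 + v) ^ (-c) * exp (-(r * v))) (Ioi 0)
      (kummer a c r) := by
  refine ⟨(hasIntegralOn_rpow_mul_exp ha hr).1.mono'
    (by fun_prop : Measurable _).aestronglyMeasurable
    (ae_restrict_of_forall_mem measurableSet_Ioi fun v hv => ?_), rfl⟩
  have hv := mem_Ioi.1 hv
  rw [norm_of_nonneg (by positivity)]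
  have h1 : (1 + v) ^ (-c) ≤ 1 := rpow_le_one_of_one_le_of_nonpos (by linarith) (by linarith)
  gcongr
  exact mul_le_of_le_one_right (by positivity) h1

theorem measurable_kummer (a c : ℝ) : Measurable (kummer a c) := by
  have h : StronglyMeasurable (Function.uncurry
      fun r v : ℝ => v ^ (a - 1) * (1 + v) ^ (-c) * exp (-(r * v))) := by
    refine Measurable.stronglyMeasurable ?_
    unfold Function.uncurry
    fun_prop
  exact h.integral_prod_right.measurable

theorem kummer_nonneg (a c r : ℝ) : 0 ≤ kummer a c r :=
  setIntegral_nonneg measurableSet_Ioi fun v hv => by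
    have := mem_Ioi.1 hv
    positivity

theorem kummer_pos {a c r : ℝ} (ha : 0 < a) (hc : 0 ≤ c) (hr : 0 < r) : 0 < kummer a c r := by
  have hpos : ∀ v ∈ Ioi (0 : ℝ), 0 < v ^ (a - 1) * (1 + v) ^ (-c) * exp (-(r * v)) := by
    intro v hv
    have := mem_Ioi.1 hv
    positivity
  have hsupp : Ioi 0 ⊆ Function.support fun v : ℝ =>
      v ^ (a - 1) * (1 + v) ^ (-c) * exp (-(r * v)) := fun v hv => (hpos v hv).ne'
  rw [kummer, setIntegral_pos_iff_support_of_nonneg_ae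
    (ae_restrict_of_forall_mem measurableSet_Ioi fun v hv => (hpos v hv).le)
    (hasIntegralOn_kummer ha hc hr).1, inter_eq_right.2 hsupp]
  simp

theorem kummer_le {a b c r : ℝ} (hb : 0 ≤ b) (hbc : b ≤ c) (hba : b < a) (hr : 0 < r) :
    kummer a c r ≤ r ^ (b - a) * Gamma (a - b) := by
  rw [← neg_sub a b]
  refine (hasIntegralOn_kummer (by linarith) (by linarith) hr).mono
    (hasIntegralOn_rpow_mul_exp (sub_pos.2 hba) hr) measurableSet_Ioi fun v hv => ?_
  have hv := mem_Ioi.1 hv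
  have hle : (1 + v) ^ (-c) ≤ v ^ (-b) :=
    (rpow_le_rpow_of_exponent_le (by linarith) (neg_le_neg hbc)).trans (one_add_rpow_neg_le hb hv)
  rw [show a - b - 1 = a - 1 + -b by ring, rpow_add hv]
  gcongr

theorem kummer_le_kummer {a c r t : ℝ} (ha : 0 < a) (hc : 0 ≤ c) (hr : 0 < r) (hrt : r ≤ t) :
    kummer a c t ≤ kummer a c r := by
  refine (hasIntegralOn_kummer ha hc (hr.trans_le hrt)).mono (hasIntegralOn_kummer ha hc hr)
    measurableSet_Ioi fun v hv => ?_
  have := mem_Ioi.1 hv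
  gcongr

theorem hasIntegralOn_kummer_rescaled {a c r : ℝ} (ha : 0 < a) (hc : 0 ≤ c) (hr : 0 < r) :
    HasIntegralOn (fun w => r ^ (c - a) * (w ^ (a - 1) * (r + w) ^ (-c) * exp (-w))) (Ioi 0)
      (kummer a c r) := by
  have hK := hasIntegralOn_kummer ha hc hr
  have hr' : 0 < r⁻¹ := inv_pos.2 hr
  have hscaled : HasIntegralOn (fun w => r⁻¹ * ((r⁻¹ * w) ^ (a - 1) * (1 + r⁻¹ * w) ^ (-c) *
      exp (-(r * (r⁻¹ * w))))) (Ioi 0) (kummer a c r) := by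
    set f : ℝ → ℝ := fun v => v ^ (a - 1) * (1 + v) ^ (-c) * exp (-(r * v))
    have hint : IntegrableOn (fun w => f (r⁻¹ * w)) (Ioi 0) :=
      (integrableOn_Ioi_comp_mul_left_iff f 0 hr').2 (by simpa only [mul_zero] using hK.1)
    refine ⟨Integrable.const_mul hint _, ?_⟩
    rw [integral_const_mul, integral_comp_mul_left_Ioi f 0 hr', mul_zero, inv_inv,
      smul_eq_mul, inv_mul_cancel_left₀ hr.ne', kummer]
  refine hscaled.congr measurableSet_Ioi (fun w hw => ?_) rfl
  have hw := mem_Ioi.1 hw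
  rw [show 1 + r⁻¹ * w = r⁻¹ * (r + w) by field_simp, mul_inv_cancel_left₀ hr.ne',
    mul_rpow hr'.le hw.le, mul_rpow hr'.le (by linarith), inv_rpow hr.le, inv_rpow hr.le,
    ← rpow_neg hr.le, ← rpow_neg hr.le, show c - a = -1 + -(a - 1) + - -c by ring, rpow_add hr,
    rpow_add hr, rpow_neg_one]
  ring

theorem rpow_mul_kummer_one_le {a c r : ℝ} (ha : 0 < a) (hc : 0 ≤ c) (hr : 0 < r) (hr1 : r ≤ 1) :
    r ^ (c - a) * kummer a c 1 ≤ kummer a c r := by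
  refine ((hasIntegralOn_kummer ha hc one_pos).const_mul (r ^ (c - a))).mono
    (hasIntegralOn_kummer_rescaled ha hc hr) measurableSet_Ioi fun w hw => ?_
  have hw := mem_Ioi.1 hw
  rw [one_mul]
  gcongr r ^ (c - a) * (w ^ (a - 1) * ?_ * exp (-w))
  exact rpow_le_rpow_of_nonpos (by linarith) (by linarith) (by linarith)

theorem integrableOn_rpow_mul_kummer {a c p t : ℝ} (ha : 0 < a) (hc : 0 < c) (ht : 0 < t)
    (hp : -1 < p) (hpc : -1 < p + (c - a)) :
    IntegrableOn (fun r => r ^ p * kummer a c r) (Ioc 0 t) := by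
  obtain ⟨b, hmax, hmin⟩ := exists_between (show max (a - p - 1) 0 < min c a from
    max_lt (lt_min (by linarith) (by linarith)) (lt_min hc ha))
  obtain ⟨hpb, hb⟩ := max_lt_iff.1 hmax
  obtain ⟨hbc, hba⟩ := lt_min_iff.1 hmin
  have hbound := (hasIntegralOn_rpow (p := p + (b - a)) (by linarith) ht).const_mul (Gamma (a - b))
  refine hbound.1.mono' (Measurable.aestronglyMeasurable ?_)
    (ae_restrict_of_forall_mem measurableSet_Ioc fun r hr => ?_)
  · have := measurable_kummer a c
    fun_prop
  · have hrp := rpow_nonneg hr.1.le p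
    rw [norm_of_nonneg (mul_nonneg hrp (kummer_nonneg a c r)), rpow_add hr.1]
    calc r ^ p * kummer a c r ≤ r ^ p * (r ^ (b - a) * Gamma (a - b)) :=
          mul_le_mul_of_nonneg_left (kummer_le hb.le hbc.le hba hr.1) hrp
      _ = Gamma (a - b) * (r ^ p * r ^ (b - a)) := by ring

theorem neg_one_lt_of_integrableOn_rpow_mul {f : ℝ → ℝ} {k p q t : ℝ} (hk : 0 < k) (ht : 0 < t)
    (hle : ∀ r ∈ Ioc 0 t, r ^ q * k ≤ f r)
    (hf : IntegrableOn (fun r => r ^ p * f r) (Ioc 0 t)) : -1 < p + q := by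
  rw [← intervalIntegral.integrableOn_Ioo_rpow_iff ht, ← integrableOn_Ioc_iff_integrableOn_Ioo]
  refine (hf.const_mul k⁻¹).mono' (by fun_prop : Measurable _).aestronglyMeasurable
    (ae_restrict_of_forall_mem measurableSet_Ioc fun r hr => ?_)
  have hr0 := hr.1
  rw [norm_of_nonneg (by positivity), rpow_add hr0]
  calc r ^ p * r ^ q = k⁻¹ * (r ^ p * (r ^ q * k)) := by field_simp
    _ ≤ k⁻¹ * (r ^ p * f r) := by
      gcongr
      exact hle r hr

theorem integrableOn_rpow_mul_kummer_iff {a c p t : ℝ} (ha : 0 < a) (hc : 0 < c) (ht : 0 < t) :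
    IntegrableOn (fun r => r ^ p * kummer a c r) (Ioc 0 t) ↔ -1 < p ∧ -1 < p + (c - a) := by
  refine ⟨fun h => ?_, fun h => integrableOn_rpow_mul_kummer ha hc ht h.1 h.2⟩
  have ht1 : 0 < min t 1 := lt_min ht one_pos
  have hint := h.mono_set (Ioc_subset_Ioc_right (min_le_left t 1))
  have hpos := kummer_pos ha hc.le one_pos
  have hle : ∀ r ∈ Ioc 0 (min t 1), 0 < r ∧ r ≤ 1 := fun r hr => ⟨hr.1, (le_min_iff.1 hr.2).2⟩
  refine ⟨?_, neg_one_lt_of_integrableOn_rpow_mul hpos ht1 (fun r hr =>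
    rpow_mul_kummer_one_le ha hc.le (hle r hr).1 (hle r hr).2) hint⟩
  rw [← add_zero p]
  refine neg_one_lt_of_integrableOn_rpow_mul hpos ht1 (fun r hr => ?_) hint
  rw [rpow_zero, one_mul]
  exact kummer_le_kummer ha hc.le (hle r hr).1 (hle r hr).2

/-! ### Small-argument expansions -/

theorem rpow_neg_sub_le {c v : ℝ} (hc : 0 ≤ c) (hv : 0 < v) :
    v ^ (-c) - (1 + v) ^ (-c) ≤ c * v ^ (-c - 1) := by
  have hy : 0 < 1 + v⁻¹ := by positivity
  have bernoulli : 1 - c * v⁻¹ ≤ (1 + v⁻¹) ^ (-c) := by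
    rw [rpow_def_of_pos hy]
    have hlog : log (1 + v⁻¹) * c ≤ v⁻¹ * c := by
      gcongr
      linarith [log_le_sub_one_of_pos hy]
    linarith [add_one_le_exp (log (1 + v⁻¹) * -c)]
  calc v ^ (-c) - (1 + v) ^ (-c) = v ^ (-c) * (1 - (1 + v⁻¹) ^ (-c)) := by
        rw [show 1 + v = v * (1 + v⁻¹) by field_simp; ring, mul_rpow hv.le hy.le]
        ring
    _ ≤ v ^ (-c) * (c * v⁻¹) := by
        gcongr
        linarith
    _ = c * v ^ (-c - 1) := by
        rw [rpow_sub_one hv.ne']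
        ring

theorem kummer_sub_isBigO_of_lt {a c : ℝ} (hc : 0 < c) (h1 : a - 1 < c) (h2 : c < a) :
    (fun r => kummer a c r - (Gamma (a - c) * r ^ (c - a) + Gamma a * Gamma (c - a) / Gamma c))
      =O[𝓝[>] 0] fun r => r ^ (c - a + 1) := by
  have hf := hasIntegralOn_rpow_mul_sub hc h1 h2
  have h := laplace_sub_isBigO_rpow (C := c) (ε := c - a + 1) hf (by linarith) (by linarith)
    fun v hv => ?_
  · refine h.neg_left.congr' ?_ .rfl
    filter_upwards [self_mem_nhdsWithin] with r hr
    have hsub := (hasIntegralOn_rpow_mul_exp (sub_pos.2 h2) hr).sub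
      ⟨integrableOn_mul_exp_neg_mul hf.1 (mem_Ioi.1 hr).le, rfl⟩
    have hkummer := hsub.congr (g := fun v => v ^ (a - 1) * (1 + v) ^ (-c) * exp (-(r * v)))
      measurableSet_Ioi (fun v hv => by
        rw [show a - c - 1 = (a - 1) + -c by ring, rpow_add hv]
        ring) rfl
    rw [kummer, hkummer.2, neg_sub a c]
    ring
  · have hnonneg := sub_nonneg.2 (one_add_rpow_neg_le hc.le hv)
    rw [abs_of_nonneg (by positivity)]
    calc v ^ (a - 1) * (v ^ (-c) - (1 + v) ^ (-c)) ≤ v ^ (a - 1) * (c * v ^ (-c - 1)) := by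
          gcongr
          exact rpow_neg_sub_le hc.le hv
      _ = c * v ^ (-1 - (c - a + 1)) := by
          rw [show -1 - (c - a + 1) = (a - 1) + (-c - 1) by ring, rpow_add hv]
          ring

theorem kummer_self_sub_isBigO {a : ℝ} (ha : 0 < a) :
    (fun r => kummer a a r - (-log r + (-digamma a - 2 * eulerMascheroniConstant)))
      =O[𝓝[>] 0] fun r => r * log r := by
  have hf := hasIntegralOn_logKernel ha
  refine ((laplace_sub_isBigO_mul_log hf fun v hv =>
    abs_logKernel_le_one_sub_exp_div_sq ha.le hv).add log_one_add_isBigO_mul_log).congr' ?_ .rfl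
  filter_upwards [self_mem_nhdsWithin] with r hr
  have hadd := HasIntegralOn.add ⟨integrableOn_mul_exp_neg_mul hf.1 (mem_Ioi.1 hr).le, rfl⟩
    (hasIntegralOn_frullani hr)
  have hkummer := hadd.congr (g := fun v => v ^ (a - 1) * (1 + v) ^ (-a) * exp (-(r * v)))
    measurableSet_Ioi (fun v _ => by
      rw [logKernel]
      ring) rfl
  rw [kummer, hkummer.2]
  ring

theorem hasIntegralOn_rpow_mul_one_add_rpow {a c : ℝ} (ha : 0 < a) (hac : a < c) :
    HasIntegralOn (fun v => v ^ (a - 1) * (1 + v) ^ (-c)) (Ioi 0)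
      (Gamma a * Gamma (c - a) / Gamma c) := by
  simpa using hasIntegralOn_rpow_mul_add_rpow ha hac one_pos

theorem kummer_sub_isBigO_of_lt_add_one {a c : ℝ} (ha : 0 < a) (hac : a < c)
    (hca : c < a + 1) :
    (fun r => kummer a c r - Gamma a * Gamma (c - a) / Gamma c) =O[𝓝[>] 0]
      fun r => r ^ (c - a) := by
  refine laplace_sub_isBigO_rpow (C := 1) (hasIntegralOn_rpow_mul_one_add_rpow ha hac)
    (by linarith) (by linarith) fun v hv => ?_
  rw [abs_of_nonneg (by positivity), one_mul, show -1 - (c - a) = (a - 1) + -c by ring,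
    rpow_add hv]
  exact mul_le_mul_of_nonneg_left (one_add_rpow_neg_le (by linarith) hv) (by positivity)

theorem kummer_add_one_sub_isBigO {a : ℝ} (ha : 0 < a) :
    (fun r => kummer a (a + 1) r - Gamma a * Gamma (a + 1 - a) / Gamma (a + 1)) =O[𝓝[>] 0]
      fun r => r * log r := by
  refine laplace_sub_isBigO_mul_log (C := 1) (hasIntegralOn_rpow_mul_one_add_rpow ha (by linarith))
    fun v hv => ?_
  rw [abs_of_nonneg (by positivity), one_mul]
  exact rpow_mul_one_add_rpow_le ha.le hv

theorem kummer_sub_isBigO_of_add_one_lt {a c : ℝ} (ha : 0 < a) (hac : a + 1 < c) :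
    (fun r => kummer a c r - Gamma a * Gamma (c - a) / Gamma c) =O[𝓝[>] 0] fun r => r := by
  refine laplace_sub_isBigO_id (hasIntegralOn_rpow_mul_one_add_rpow ha (by linarith))
    ((hasIntegralOn_rpow_mul_one_add_rpow (by linarith) hac).1.congr_fun (fun v hv => ?_)
      measurableSet_Ioi)
  simp only [add_sub_right_comm a 1 1, rpow_add_one (mem_Ioi.1 hv).ne']
  ring

/-! ### Termwise integration of asymptotic expansions -/

theorem isBigO_setIntegral_sub {f m g M G : ℝ → ℝ} (hf : Measurable f)
    (hm : ∀ᶠ t in 𝓝[>] 0, HasIntegralOn m (Ioc 0 t) (M t))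
    (hg : ∀ᶠ t in 𝓝[>] 0, HasIntegralOn g (Ioc 0 t) (G t))
    (hg0 : ∀ᶠ r in 𝓝[>] 0, 0 ≤ g r) (h : (fun r => f r - m r) =O[𝓝[>] 0] g) :
    (fun t => (∫ r in Ioc 0 t, f r) - M t) =O[𝓝[>] 0] G := by
  obtain ⟨C, hC⟩ := h.bound
  obtain ⟨δ, hδ, hsub⟩ := mem_nhdsGT_iff_exists_Ioc_subset.1 (hC.and hg0)
  refine IsBigO.of_bound |C| ?_
  filter_upwards [hm, hg, Ioc_mem_nhdsGT hδ] with t hm hg ht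
  have hle : ∀ᵐ r ∂(volume.restrict (Ioc 0 t)), ‖f r - m r‖ ≤ C * g r :=
    ae_restrict_of_forall_mem measurableSet_Ioc fun r hr => by
      obtain ⟨hbound, hpos⟩ := hsub ⟨hr.1, hr.2.trans ht.2⟩
      rwa [norm_of_nonneg hpos] at hbound
  have hCg := hg.const_mul C
  have hdiff : IntegrableOn (fun r => f r - m r) (Ioc 0 t) :=
    hCg.1.mono' (hf.aestronglyMeasurable.sub hm.1.aestronglyMeasurable) hle
  have hfint : IntegrableOn f (Ioc 0 t) :=
    (Integrable.add hdiff hm.1).congr (.of_forall fun r => sub_add_cancel (f r) (m r))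
  rw [← hm.2, ← integral_sub hfint hm.1, ← norm_eq_abs, ← norm_mul, ← hCg.2]
  exact (norm_integral_le_of_norm_le hCg.1 hle).trans (le_norm_self _)

theorem setIntegral_rpow_mul_sub_isBigO_rpow {f m M : ℝ → ℝ} {p e : ℝ} (hf : Measurable f)
    (hpe : -1 < p + e)
    (hm : ∀ᶠ t in 𝓝[>] 0, HasIntegralOn (fun r => r ^ p * m r) (Ioc 0 t) (M t))
    (h : (fun r => f r - m r) =O[𝓝[>] 0] fun r => r ^ e) :
    (fun t => (∫ r in Ioc 0 t, r ^ p * f r) - M t) =O[𝓝[>] 0] fun t => t ^ (p + e + 1) := by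
  have hbig := isBigO_setIntegral_sub (f := fun r => r ^ p * f r) (g := fun r => r ^ (p + e))
    (by fun_prop) hm (eventually_mem_nhdsWithin.mono fun t ht => hasIntegralOn_rpow hpe ht)
    (eventually_mem_nhdsWithin.mono fun r hr => rpow_nonneg (mem_Ioi.1 hr).le _) ?_
  · simp only [div_eq_inv_mul] at hbig
    exact hbig.trans ((isBigO_refl _ _).const_mul_left _)
  · refine ((isBigO_refl (fun r : ℝ => r ^ p) _).mul h).congr' (.of_forall fun r => ?_) ?_
    · exact mul_sub _ _ _
    · exact eventually_mem_nhdsWithin.mono fun r hr => (rpow_add hr p e).symm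

theorem setIntegral_rpow_mul_sub_isBigO_mul_log {f m M : ℝ → ℝ} {p : ℝ} (hf : Measurable f)
    (hp : -2 < p)
    (hm : ∀ᶠ t in 𝓝[>] 0, HasIntegralOn (fun r => r ^ p * m r) (Ioc 0 t) (M t))
    (h : (fun r => f r - m r) =O[𝓝[>] 0] fun r => r * log r) :
    (fun t => (∫ r in Ioc 0 t, r ^ p * f r) - M t) =O[𝓝[>] 0]
      fun t => t ^ (p + 2) * log t := by
  have hlt : ∀ᶠ t : ℝ in 𝓝[>] 0, t ∈ Ioc 0 1 := Ioc_mem_nhdsGT one_pos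
  have hlog : ∀ᶠ t in 𝓝[>] 0, HasIntegralOn (fun r => -1 * (r ^ (p + 1) * log r)) (Ioc 0 t)
      (-1 * (t ^ (p + 1 + 1) * log t / (p + 1 + 1) - t ^ (p + 1 + 1) / (p + 1 + 1) ^ 2)) :=
    hlt.mono fun t ht => (hasIntegralOn_rpow_mul_log (by linarith) ht.1 ht.2).const_mul _
  have hbig := isBigO_setIntegral_sub (f := fun r => r ^ p * f r) (by fun_prop) hm hlog
    (hlt.mono fun r hr => ?_) ?_
  · rw [show p + 1 + 1 = p + 2 by ring] at hbig
    refine hbig.trans (((?_ : IsBigO _ _ _).sub ?_).const_mul_left _)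
    · simp only [div_eq_inv_mul]
      exact (isBigO_refl _ _).const_mul_left _
    · have := (isBigO_refl (fun t : ℝ => t ^ (p + 2)) (𝓝[>] 0)).mul one_isBigO_log
      simp only [div_eq_inv_mul, mul_one] at this ⊢
      exact this.const_mul_left _
  · have := log_nonpos hr.1.le hr.2
    have := mul_nonneg (rpow_nonneg hr.1.le (p + 1)) (neg_nonneg.2 this)
    linarith
  · refine ((isBigO_refl (fun r : ℝ => r ^ p) _).mul h.neg_right).congr'
      (.of_forall fun r => mul_sub _ _ _) ?_
    filter_upwards [self_mem_nhdsWithin] with r hr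
    rw [rpow_add_one (mem_Ioi.1 hr).ne']
    ring

theorem hasIntegralOn_rpow_mul_const_mul_rpow {p q t : ℝ} (k : ℝ) (hpq : -1 < p + q)
    (ht : 0 < t) :
    HasIntegralOn (fun r => r ^ p * (k * r ^ q)) (Ioc 0 t)
      (k * (t ^ (p + q + 1) / (p + q + 1))) :=
  ((hasIntegralOn_rpow hpq ht).const_mul k).congr measurableSet_Ioc
    (fun r hr => by rw [rpow_add hr.1, mul_left_comm]) rfl

theorem hasIntegralOn_rpow_mul_const {p t : ℝ} (k : ℝ) (hp : -1 < p) (ht : 0 < t) :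
    HasIntegralOn (fun r => r ^ p * k) (Ioc 0 t) (k * (t ^ (p + 1) / (p + 1))) :=
  ((hasIntegralOn_rpow hp ht).const_mul k).congr measurableSet_Ioc
    (fun _ _ => mul_comm _ _) rfl

/-! ### Gaussian mixtures -/

section Gaussian

variable {V : Type*} [NormedAddCommGroup V] [InnerProductSpace ℝ V]

theorem norm_cexp_neg_I_mul_inner_mul_gaussian (x ξ : V) (u : ℝ) :
    ‖Complex.exp (-(Complex.I * ((inner ℝ x ξ : ℝ) : ℂ))) * (exp (-(‖x‖ ^ 2 / (4 * u))) : ℝ)‖ =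
      exp (-(‖x‖ ^ 2 / (4 * u))) := by
  rw [norm_mul, Complex.norm_real, norm_of_nonneg (exp_pos _).le, Complex.norm_exp]
  simp

theorem cexp_neg_I_mul_inner_mul_gaussian (x ξ : V) (u : ℝ) :
    Complex.exp (-(Complex.I * ((inner ℝ x ξ : ℝ) : ℂ))) * (exp (-(‖x‖ ^ 2 / (4 * u))) : ℝ) =
      Complex.exp (-((1 / (4 * u) : ℝ) : ℂ) * (‖x‖ : ℂ) ^ 2 +
        -Complex.I * ((inner ℝ ξ x : ℝ) : ℂ)) := by
  rw [Complex.ofReal_exp, ← Complex.exp_add, real_inner_comm]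
  push_cast
  ring_nf

variable [FiniteDimensional ℝ V] [MeasurableSpace V] [BorelSpace V] {u : ℝ}

theorem integral_gaussian (hu : 0 < u) :
    ∫ x : V, exp (-(‖x‖ ^ 2 / (4 * u))) = (4 * π * u) ^ (Module.finrank ℝ V / 2 : ℝ) := by
  have h := GaussianFourier.integral_rexp_neg_mul_sq_norm (V := V)
    (show 0 < 1 / (4 * u) by positivity)
  rw [show π / (1 / (4 * u)) = 4 * π * u by field_simp] at h
  rw [← h]
  congr! 3
  ring

theorem integrable_cexp_neg_I_mul_inner_mul_gaussian (hu : 0 < u) (ξ : V) :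
    Integrable fun x : V => Complex.exp (-(Complex.I * ((inner ℝ x ξ : ℝ) : ℂ))) *
      (exp (-(‖x‖ ^ 2 / (4 * u))) : ℝ) := by
  simp only [cexp_neg_I_mul_inner_mul_gaussian]
  refine GaussianFourier.integrable_cexp_neg_mul_sq_norm_add ?_ _ _
  rw [Complex.ofReal_re]
  positivity

theorem integral_cexp_neg_I_mul_inner_mul_gaussian (hu : 0 < u) (ξ : V) :
    ∫ x : V, Complex.exp (-(Complex.I * ((inner ℝ x ξ : ℝ) : ℂ))) *
      (exp (-(‖x‖ ^ 2 / (4 * u))) : ℝ) =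
      ((4 * π * u) ^ (Module.finrank ℝ V / 2 : ℝ) * exp (-(u * ‖ξ‖ ^ 2)) : ℝ) := by
  have hb : 0 < ((1 / (4 * u) : ℝ) : ℂ).re := by
    rw [Complex.ofReal_re]
    positivity
  have hu' : (u : ℂ) ≠ 0 := by exact_mod_cast hu.ne'
  simp only [cexp_neg_I_mul_inner_mul_gaussian]
  rw [GaussianFourier.integral_cexp_neg_mul_sq_norm_add hb, neg_sq, Complex.I_sq]
  push_cast [Complex.ofReal_cpow (show 0 ≤ 4 * π * u by positivity)]
  congr! 2
  · field_simp
  · field_simp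

end Gaussian

theorem integrable_gaussian_mixture {d : ℕ} {w : ℝ → ℝ} (hw : Measurable w)
    (hint : IntegrableOn (fun u => w u * (4 * π * u) ^ ((d : ℝ) / 2)) (Ioi 0))
    (ξ : EuclideanSpace ℝ (Fin d)) :
    Integrable (Function.uncurry fun (x : EuclideanSpace ℝ (Fin d)) (u : ℝ) =>
      (w u : ℂ) * (Complex.exp (-(Complex.I * ((inner ℝ x ξ : ℝ) : ℂ))) *
        (exp (-(‖x‖ ^ 2 / (4 * u))) : ℝ))) (volume.prod (volume.restrict (Ioi 0))) := by
  have hmeas : Measurable (Function.uncurry fun (x : EuclideanSpace ℝ (Fin d)) (u : ℝ) =>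
      (w u : ℂ) * (Complex.exp (-(Complex.I * ((inner ℝ x ξ : ℝ) : ℂ))) *
        (exp (-(‖x‖ ^ 2 / (4 * u))) : ℝ))) := by
    unfold Function.uncurry
    fun_prop
  refine (integrable_prod_iff' hmeas.aestronglyMeasurable).2
    ⟨ae_restrict_of_forall_mem measurableSet_Ioi fun u hu =>
      (integrable_cexp_neg_I_mul_inner_mul_gaussian hu ξ).const_mul (w u : ℂ),
    hint.norm.congr (ae_restrict_of_forall_mem measurableSet_Ioi fun u hu => ?_)⟩
  have hu := mem_Ioi.1 hu
  simp only [Function.uncurry_apply_pair, norm_mul (w u : ℂ), Complex.norm_real,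
    norm_cexp_neg_I_mul_inner_mul_gaussian]
  rw [integral_const_mul, integral_gaussian hu, finrank_euclideanSpace_fin, norm_mul,
    norm_of_nonneg (by positivity : 0 ≤ (4 * π * u) ^ ((d : ℝ) / 2))]

theorem fourierTransform_gaussian_mixture {d : ℕ} {w : ℝ → ℝ} (hw : Measurable w)
    (hint : IntegrableOn (fun u => w u * (4 * π * u) ^ ((d : ℝ) / 2)) (Ioi 0))
    (ξ : EuclideanSpace ℝ (Fin d)) :
    fourierTransform (fun x => ∫ u in Ioi 0, w u * exp (-(‖x‖ ^ 2 / (4 * u)))) ξ =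
      (∫ u in Ioi 0, w u * ((4 * π * u) ^ ((d : ℝ) / 2) * exp (-(u * ‖ξ‖ ^ 2))) : ℝ) := by
  calc
    _ = ∫ x : EuclideanSpace ℝ (Fin d), ∫ u in Ioi 0, (w u : ℂ) *
          (Complex.exp (-(Complex.I * ((inner ℝ x ξ : ℝ) : ℂ))) *
            (exp (-(‖x‖ ^ 2 / (4 * u))) : ℝ)) := by
      refine integral_congr_ae (.of_forall fun x => ?_)
      simp only [← integral_complex_ofReal, ← integral_const_mul]
      congr! 2
      push_cast
      ring
    _ = ∫ u in Ioi 0, ((w u * ((4 * π * u) ^ ((d : ℝ) / 2) * exp (-(u * ‖ξ‖ ^ 2))) : ℝ) : ℂ) := by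
      rw [integral_integral_swap (integrable_gaussian_mixture hw hint ξ)]
      refine setIntegral_congr_fun measurableSet_Ioi fun u hu => ?_
      simp only [integral_const_mul]
      rw [integral_cexp_neg_I_mul_inner_mul_gaussian hu, finrank_euclideanSpace_fin,
        Complex.ofReal_mul (w u)]
    _ = _ := integral_complex_ofReal

/-! ### The Bessel kernel -/

theorem besselKernel_eq_gaussian_mixture (d : ℕ) (s : ℝ) :
    besselKernel d s = fun x => ∫ u in Ioi 0, ((4 * π) ^ ((d : ℝ) / 2) * Gamma (s / 2))⁻¹ *
      (exp (-u) * u ^ ((s - d) / 2 - 1)) * exp (-(‖x‖ ^ 2 / (4 * u))) := by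
  ext x
  rw [besselKernel, ← integral_const_mul]
  congr! 2
  rw [sub_eq_add_neg, exp_add]
  ring

theorem hasIntegralOn_besselKernel_weight (d : ℕ) {s y : ℝ} (hs : 0 < s) (hy : 0 ≤ y) :
    HasIntegralOn (fun u => ((4 * π) ^ ((d : ℝ) / 2) * Gamma (s / 2))⁻¹ *
      (exp (-u) * u ^ ((s - d) / 2 - 1)) * ((4 * π * u) ^ ((d : ℝ) / 2) * exp (-(u * y))))
      (Ioi 0) ((1 + y) ^ (-(s / 2))) := by
  have : 0 < Gamma (s / 2) := Gamma_pos_of_pos (half_pos hs)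
  have : 0 < (4 * π) ^ ((d : ℝ) / 2) := by positivity
  refine ((hasIntegralOn_rpow_mul_exp (half_pos hs) (show 0 < 1 + y by linarith)).const_mul
    (Gamma (s / 2))⁻¹).congr measurableSet_Ioi (fun u hu => ?_) (by field_simp)
  rw [mul_rpow (by positivity) (mem_Ioi.1 hu).le,
    show s / 2 - 1 = ((s - d) / 2 - 1) + (d : ℝ) / 2 by ring, rpow_add hu,
    show -((1 + y) * u) = -u + -(u * y) by ring, exp_add]
  field_simp

theorem fourierTransform_besselKernel {d : ℕ} {s : ℝ} (hs : 0 < s)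
    (ξ : EuclideanSpace ℝ (Fin d)) :
    fourierTransform (besselKernel d s) ξ = ((1 + ‖ξ‖ ^ 2) ^ (-(s / 2)) : ℝ) := by
  have hweight := (hasIntegralOn_besselKernel_weight d hs le_rfl).1
  simp only [mul_zero, neg_zero, exp_zero, mul_one] at hweight
  rw [besselKernel_eq_gaussian_mixture, fourierTransform_gaussian_mixture (by fun_prop) hweight,
    (hasIntegralOn_besselKernel_weight d hs (sq_nonneg ‖ξ‖)).2]

theorem lintegral_spectralMeasure_besselKernel {d : ℕ} {s : ℝ} (hs : 0 < s)
    {g : EuclideanSpace ℝ (Fin d) → ENNReal} (hg : Measurable g) :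
    ∫⁻ ξ, g ξ ∂(spectralMeasure (besselKernel d s)) =
      ∫⁻ ξ, ENNReal.ofReal ((1 + ‖ξ‖ ^ 2) ^ (-(s / 2))) * g ξ := by
  simp only [spectralMeasure, fourierTransform_besselKernel hs, Complex.ofReal_re]
  exact lintegral_withDensity_eq_lintegral_mul _ (by fun_prop) hg

/-! ### Radial integration -/

theorem hasIntegralOn_pow_mul_comp_sq {n : ℕ} {f : ℝ → ℝ} {A : ℝ} (hn : 0 < n)
    (hf : HasIntegralOn (fun v => v ^ ((n : ℝ) / 2 - 1) * f v) (Ioi 0) A) :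
    HasIntegralOn (fun y => y ^ (n - 1) * f (y ^ 2)) (Ioi 0) (A / 2) := by
  have hsubst : HasIntegralOn (fun y : ℝ => (|2| * y ^ ((2 : ℝ) - 1)) •
      ((y ^ (2 : ℝ)) ^ ((n : ℝ) / 2 - 1) * f (y ^ (2 : ℝ)))) (Ioi 0) A :=
    ⟨(integrableOn_Ioi_comp_rpow_iff (fun v => v ^ ((n : ℝ) / 2 - 1) * f v) two_ne_zero).2 hf.1,
      (integral_comp_rpow_Ioi (fun v => v ^ ((n : ℝ) / 2 - 1) * f v) two_ne_zero).trans hf.2⟩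
  refine (hsubst.const_mul (1 / 2)).congr measurableSet_Ioi (fun y hy => ?_) (by ring)
  have hy := mem_Ioi.1 hy
  have hpow : y ^ (n - 1) = y ^ ((2 : ℝ) - 1) * y ^ ((2 : ℝ) * ((n : ℝ) / 2 - 1)) := by
    rw [← rpow_add hy, ← rpow_natCast, Nat.cast_pred hn]
    ring_nf
  rw [← rpow_mul hy.le, hpow, abs_two, smul_eq_mul, rpow_two]
  ring

section Radial

variable {V : Type*} [NormedAddCommGroup V] [InnerProductSpace ℝ V] [FiniteDimensional ℝ V]
  [MeasurableSpace V] [BorelSpace V] [Nontrivial V]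

variable (V) in
theorem volume_real_ball_zero_one : volume.real (Metric.ball (0 : V) 1) =
    π ^ (Module.finrank ℝ V / 2 : ℝ) / Gamma (Module.finrank ℝ V / 2 + 1) := by
  have : 0 < Gamma (Module.finrank ℝ V / 2 + 1) := Gamma_pos_of_pos (by positivity)
  rw [Measure.real, InnerProductSpace.volume_ball, ENNReal.ofReal_one, one_pow, one_mul,
    ENNReal.toReal_ofReal (by positivity), sqrt_eq_rpow, ← rpow_mul_natCast pi_pos.le,
    one_div_mul_eq_div]

theorem hasIntegralOn_comp_norm_sq {f : ℝ → ℝ} {A : ℝ} (hf : HasIntegralOn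
      (fun v => v ^ (Module.finrank ℝ V / 2 - 1 : ℝ) * f v) (Ioi 0) A) :
    HasIntegralOn (fun ξ : V => f (‖ξ‖ ^ 2)) univ
      (π ^ (Module.finrank ℝ V / 2 : ℝ) / Gamma (Module.finrank ℝ V / 2) * A) := by
  have hn : 0 < Module.finrank ℝ V := Module.finrank_pos
  have hn2 : (0 : ℝ) < Module.finrank ℝ V / 2 := by positivity
  have hradial := hasIntegralOn_pow_mul_comp_sq hn hf
  refine ⟨?_, ?_⟩
  · rw [integrableOn_univ, integrable_fun_norm_addHaar volume (f := fun y => f (y ^ 2))]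
    exact hradial.1
  · have := Gamma_pos_of_pos hn2
    rw [setIntegral_univ, integral_fun_norm_addHaar volume (fun y => f (y ^ 2)),
      volume_real_ball_zero_one, Gamma_add_one hn2.ne']
    simp only [smul_eq_mul, nsmul_eq_mul, hradial.2]
    field_simp

end Radial

theorem lintegral_comp_norm_sq {d : ℕ} {f : ℝ → ℝ} {A : ℝ} (hd : 0 < d)
    (hf : HasIntegralOn (fun v => v ^ ((d : ℝ) / 2 - 1) * f v) (Ioi 0) A)
    (h0 : ∀ v, 0 ≤ v → 0 ≤ f v) :
    ∫⁻ ξ : EuclideanSpace ℝ (Fin d), ENNReal.ofReal (f (‖ξ‖ ^ 2)) =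
      ENNReal.ofReal (π ^ ((d : ℝ) / 2) / Gamma ((d : ℝ) / 2) * A) := by
  have : Nonempty (Fin d) := ⟨⟨0, hd⟩⟩
  have hradial := hasIntegralOn_comp_norm_sq (V := EuclideanSpace ℝ (Fin d)) (f := f) (A := A)
    (by rwa [finrank_euclideanSpace_fin])
  rw [finrank_euclideanSpace_fin] at hradial
  rw [← hradial.lintegral_ofReal MeasurableSet.univ fun ξ _ => h0 _ (sq_nonneg _),
    Measure.restrict_univ]

/-! ### The value of `Υ_α(0)` -/

theorem lintegral_rpow_norm_mul_rpow_one_add {d : ℕ} {s α : ℝ} (hd : 0 < d)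
    (h0 : 0 < (d : ℝ) - 2 * (1 - α)) (h1 : (d : ℝ) - 2 * (1 - α) < s) :
    ∫⁻ ξ : EuclideanSpace ℝ (Fin d), ENNReal.ofReal ((1 + ‖ξ‖ ^ 2) ^ (-(s / 2))) *
        (ENNReal.ofReal (0 + ‖ξ‖ ^ 2) ^ (1 - α))⁻¹ =
      ENNReal.ofReal (π ^ ((d : ℝ) / 2) / Gamma ((d : ℝ) / 2) *
        (Gamma ((d : ℝ) / 2 - 1 + α) * Gamma ((s - d) / 2 + 1 - α) / Gamma (s / 2))) := by
  have : Nonempty (Fin d) := ⟨⟨0, hd⟩⟩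
  have hbeta : HasIntegralOn (fun v => v ^ ((d : ℝ) / 2 - 1) *
      (v ^ (-(1 - α)) * (1 + v) ^ (-(s / 2)))) (Ioi 0)
      (Gamma ((d : ℝ) / 2 - 1 + α) * Gamma ((s - d) / 2 + 1 - α) / Gamma (s / 2)) := by
    refine (hasIntegralOn_rpow_mul_one_add_rpow (a := (d : ℝ) / 2 - 1 + α) (c := s / 2)
      (by linarith) (by linarith)).congr measurableSet_Ioi (fun v hv => ?_) ?_
    · rw [← mul_assoc, ← rpow_add (mem_Ioi.1 hv)]
      ring_nf
    · ring_nf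
  rw [← lintegral_comp_norm_sq hd hbeta fun v hv => by positivity]
  refine lintegral_congr_ae ?_
  filter_upwards [Measure.ae_ne volume (0 : EuclideanSpace ℝ (Fin d))] with ξ hξ
  have hpos : 0 < ‖ξ‖ ^ 2 := pow_pos (norm_pos_iff.2 hξ) 2
  rw [zero_add, ENNReal.ofReal_rpow_of_pos hpos, ← ENNReal.ofReal_inv_of_pos (by positivity),
    ← ENNReal.ofReal_mul (by positivity), rpow_neg hpos.le, mul_comm]

theorem upsilon_besselKernel {d : ℕ} {s α : ℝ} (hd : 0 < d) (hs : 0 < s)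
    (h0 : 0 < (d : ℝ) - 2 * (1 - α)) (h1 : (d : ℝ) - 2 * (1 - α) < s) :
    upsilon (spectralMeasure (besselKernel d s)) α 0 =
      ENNReal.ofReal (Gamma ((d : ℝ) / 2 - 1 + α) * Gamma ((s - d) / 2 + 1 - α) /
        (2 ^ d * π ^ ((d : ℝ) / 2) * Gamma ((d : ℝ) / 2) * Gamma (s / 2))) := by
  have hpi : π ^ d = π ^ ((d : ℝ) / 2) * π ^ ((d : ℝ) / 2) := by
    rw [← rpow_add pi_pos, add_halves, rpow_natCast]
  have : 0 < π ^ ((d : ℝ) / 2) := by positivity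
  rw [upsilon, lintegral_spectralMeasure_besselKernel hs (by fun_prop),
    lintegral_rpow_norm_mul_rpow_one_add hd h0 h1, ← ENNReal.ofReal_mul (by positivity),
    mul_pow, hpi]
  congr 1
  field_simp

theorem upsilon_zero_besselKernel {d : ℕ} {s : ℝ} (hs : 0 < s) (h0 : 0 < (d : ℝ) - 2)
    (h1 : (d : ℝ) - 2 < s) :
    upsilon (spectralMeasure (besselKernel d s)) 0 0 =
      ENNReal.ofReal (Gamma ((2 + s - d) / 2) /
        (2 ^ ((d : ℝ) - 1) * π ^ ((d : ℝ) / 2) * ((d : ℝ) - 2) * Gamma (s / 2))) := by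
  have hd : 0 < d := Nat.cast_pos.1 (by linarith : (0 : ℝ) < d)
  have hne : (d : ℝ) / 2 - 1 ≠ 0 := by linarith
  have := Gamma_pos_of_pos (show 0 < (d : ℝ) / 2 - 1 by linarith)
  have hrec : Gamma ((d : ℝ) / 2) = ((d : ℝ) / 2 - 1) * Gamma ((d : ℝ) / 2 - 1) := by
    rw [← Gamma_add_one hne, sub_add_cancel]
  rw [upsilon_besselKernel hd hs (by linarith) (by linarith), hrec, rpow_sub_one two_ne_zero,
    rpow_natCast, add_zero, show (s - d) / 2 + 1 - 0 = (2 + s - d) / 2 by ring,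
    show (d : ℝ) - 2 = 2 * ((d : ℝ) / 2 - 1) by ring]
  congr 1
  field_simp

/-! ### The function `𝓗_α` -/

theorem calH_besselKernel {d : ℕ} {s : ℝ} (hd : 0 < d) (hs : 0 < s) (α t : ℝ) :
    calH (spectralMeasure (besselKernel d s)) α t =
      ∫⁻ r in Ioc 0 t, ENNReal.ofReal (π ^ ((d : ℝ) / 2) / Gamma ((d : ℝ) / 2) *
        (r ^ (-(2 * α)) * kummer ((d : ℝ) / 2) (s / 2) r)) := by
  have hd0 : (0 : ℝ) < (d : ℝ) / 2 := half_pos (Nat.cast_pos.2 hd)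
  refine setLIntegral_congr_fun measurableSet_Ioc fun r hr => ?_
  have hkummer : HasIntegralOn (fun v => v ^ ((d : ℝ) / 2 - 1) *
      ((1 + v) ^ (-(s / 2)) * exp (-(r * v)))) (Ioi 0) (kummer ((d : ℝ) / 2) (s / 2) r) := by
    simpa only [mul_assoc] using hasIntegralOn_kummer hd0 (half_pos hs).le hr.1
  have hradial := lintegral_comp_norm_sq hd hkummer fun v hv => by positivity
  rw [mul_left_comm, ENNReal.ofReal_mul (rpow_nonneg hr.1.le _), ← hradial,
    lintegral_spectralMeasure_besselKernel hs (by fun_prop)]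
  congr 1
  exact lintegral_congr fun ξ => (ENNReal.ofReal_mul (by positivity)).symm

theorem rpow_mul_kummer_nonneg (a c p : ℝ) {r : ℝ} (hr : 0 ≤ r) : 0 ≤ r ^ p * kummer a c r :=
  mul_nonneg (rpow_nonneg hr p) (kummer_nonneg a c r)

theorem pi_rpow_div_Gamma_pos {d : ℕ} (hd : 0 < d) :
    0 < π ^ ((d : ℝ) / 2) / Gamma ((d : ℝ) / 2) := by
  have := Gamma_pos_of_pos (half_pos (Nat.cast_pos.2 hd) : (0 : ℝ) < (d : ℝ) / 2)
  positivity

theorem calH_besselKernel_lt_top_iff {d : ℕ} {s t : ℝ} (hd : 0 < d) (hs : 0 < s) (ht : 0 < t)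
    (α : ℝ) : calH (spectralMeasure (besselKernel d s)) α t < ⊤ ↔
      α < 1 / 2 - max ((d : ℝ) - s) 0 / 4 := by
  have hpos := pi_rpow_div_Gamma_pos hd
  have hmeas := measurable_kummer ((d : ℝ) / 2) (s / 2)
  rw [calH_besselKernel hd hs, lt_top_iff_ne_top, lintegral_ofReal_ne_top_iff_integrable
    (Measurable.aestronglyMeasurable (by fun_prop))
    (ae_restrict_of_forall_mem measurableSet_Ioc fun r hr =>
      mul_nonneg hpos.le (rpow_mul_kummer_nonneg _ _ _ hr.1.le)),
    integrable_const_mul_iff hpos.ne'.isUnit, ← IntegrableOn,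
    integrableOn_rpow_mul_kummer_iff (half_pos (Nat.cast_pos.2 hd)) (half_pos hs) ht,
    ← sub_pos (b := α), sub_right_comm, sub_pos, div_lt_iff₀ four_pos, max_lt_iff, and_comm]
  constructor <;> rintro ⟨h1, h2⟩ <;> constructor <;> linarith

theorem toReal_calH_besselKernel {d : ℕ} {s : ℝ} (hd : 0 < d) (hs : 0 < s) (α t : ℝ) :
    (calH (spectralMeasure (besselKernel d s)) α t).toReal =
      π ^ ((d : ℝ) / 2) / Gamma ((d : ℝ) / 2) *
        ∫ r in Ioc 0 t, r ^ (-(2 * α)) * kummer ((d : ℝ) / 2) (s / 2) r := by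
  have hmeas := measurable_kummer ((d : ℝ) / 2) (s / 2)
  rw [calH_besselKernel hd hs, ← integral_const_mul, integral_eq_lintegral_of_nonneg_ae
    (ae_restrict_of_forall_mem measurableSet_Ioc fun r hr =>
      mul_nonneg (pi_rpow_div_Gamma_pos hd).le (rpow_mul_kummer_nonneg _ _ _ hr.1.le))
    (Measurable.aestronglyMeasurable (by fun_prop))]

theorem toReal_calH_besselKernel_sub_isBigO {d : ℕ} {s α : ℝ} {M T g : ℝ → ℝ} (hd : 0 < d)
    (hs : 0 < s) (h : (fun t => (∫ r in Ioc 0 t,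
      r ^ (-(2 * α)) * kummer ((d : ℝ) / 2) (s / 2) r) - M t) =O[𝓝[>] 0] g)
    (hT : ∀ t, π ^ ((d : ℝ) / 2) / Gamma ((d : ℝ) / 2) * M t = T t) :
    (fun t => (calH (spectralMeasure (besselKernel d s)) α t).toReal - T t) =O[𝓝[>] 0] g := by
  simpa only [toReal_calH_besselKernel hd hs, ← hT, ← mul_sub] using h.const_mul_left _

theorem calH_besselKernel_isBigO_of_lt {d : ℕ} {s α : ℝ} (hd : 0 < d) (hs : 0 < s)
    (hα : α < 1 / 2) (h1 : (d : ℝ) - 2 < s) (h2 : s < d) (h3 : α < 1 / 2 - (d - s) / 4) :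
    (fun t => (calH (spectralMeasure (besselKernel d s)) α t).toReal -
        (π ^ ((d : ℝ) / 2) * Gamma ((d - s) / 2) /
            (((s - d) / 2 + 1 - 2 * α) * Gamma ((d : ℝ) / 2)) * t ^ ((s - d) / 2 + 1 - 2 * α) +
          π ^ ((d : ℝ) / 2) * Gamma ((s - d) / 2) /
            ((1 - 2 * α) * Gamma (s / 2)) * t ^ (1 - 2 * α)))
      =O[𝓝[>] 0] fun t => t ^ ((s - d) / 2 + 2 * (1 - α)) := by
  have hd0 : (0 : ℝ) < (d : ℝ) / 2 := half_pos (Nat.cast_pos.2 hd)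
  have hdiff : s / 2 - (d : ℝ) / 2 = (s - d) / 2 := by ring
  have hdiff' : (d : ℝ) / 2 - s / 2 = (d - s) / 2 := by ring
  have hexp : -(2 * α) + (s - d) / 2 + 1 = (s - d) / 2 + 1 - 2 * α := by ring
  have hexp' : -(2 * α) + 1 = 1 - 2 * α := by ring
  have hK := kummer_sub_isBigO_of_lt (half_pos hs) (by linarith) (by linarith : s / 2 < (d : ℝ) / 2)
  rw [hdiff, hdiff'] at hK
  have hint := setIntegral_rpow_mul_sub_isBigO_rpow (p := -(2 * α)) (measurable_kummer _ _)
    (by linarith) (eventually_mem_nhdsWithin.mono fun t ht =>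
      ((hasIntegralOn_rpow_mul_const_mul_rpow _ (by linarith) ht).add
        (hasIntegralOn_rpow_mul_const _ (by linarith) ht)).congr measurableSet_Ioc
        (fun r _ => (mul_add _ _ _).symm) rfl) hK
  rw [show -(2 * α) + ((s - d) / 2 + 1) + 1 = (s - d) / 2 + 2 * (1 - α) by ring] at hint
  refine toReal_calH_besselKernel_sub_isBigO hd hs hint fun t => ?_
  have := Gamma_pos_of_pos hd0
  rw [hexp, hexp']
  field_simp

theorem calH_besselKernel_isBigO_of_eq {d : ℕ} {s α : ℝ} (hd : 0 < d) (hα : α < 1 / 2)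
    (h : s = d) :
    (fun t => (calH (spectralMeasure (besselKernel d s)) α t).toReal -
        (π ^ ((d : ℝ) / 2) / ((1 - 2 * α) * Gamma ((d : ℝ) / 2)) * t ^ (1 - 2 * α) * log (1 / t) +
          π ^ ((d : ℝ) / 2) *
              (1 - (1 - 2 * α) * (digamma ((d : ℝ) / 2) + 2 * eulerMascheroniConstant)) /
            ((1 - 2 * α) ^ 2 * Gamma ((d : ℝ) / 2)) * t ^ (1 - 2 * α)))
      =O[𝓝[>] 0] fun t => t ^ (2 * (1 - α)) * log t := by
  have hd0 : (0 : ℝ) < (d : ℝ) / 2 := half_pos (Nat.cast_pos.2 hd)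
  subst h
  have hint := setIntegral_rpow_mul_sub_isBigO_mul_log (p := -(2 * α)) (measurable_kummer _ _)
    (by linarith) (Eventually.mono (Ioc_mem_nhdsGT one_pos) fun t ht =>
      ((hasIntegralOn_rpow_mul_const (p := -(2 * α))
        (-digamma ((d : ℝ) / 2) - 2 * eulerMascheroniConstant) (by linarith) ht.1).sub
        (hasIntegralOn_rpow_mul_log (p := -(2 * α)) (by linarith) ht.1 ht.2)).congr
        measurableSet_Ioc (fun r _ => by ring) rfl) (kummer_self_sub_isBigO hd0)
  rw [show -(2 * α) + 2 = 2 * (1 - α) by ring] at hint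
  refine toReal_calH_besselKernel_sub_isBigO hd (Nat.cast_pos.2 hd) hint fun t => ?_
  have := Gamma_pos_of_pos hd0
  have : 0 < 1 - 2 * α := by linarith
  rw [one_div, log_inv, show -(2 * α) + 1 = 1 - 2 * α by ring]
  field_simp
  ring

theorem calH_besselKernel_main_term_eq {d : ℕ} {s : ℝ} (hd : 0 < d) (α t : ℝ) :
    π ^ ((d : ℝ) / 2) / Gamma ((d : ℝ) / 2) *
        (Gamma ((d : ℝ) / 2) * Gamma (s / 2 - (d : ℝ) / 2) / Gamma (s / 2) *
          (t ^ (-(2 * α) + 1) / (-(2 * α) + 1))) =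
      π ^ ((d : ℝ) / 2) * Gamma ((s - d) / 2) / ((1 - 2 * α) * Gamma (s / 2)) *
        t ^ (1 - 2 * α) := by
  have := Gamma_pos_of_pos (half_pos (Nat.cast_pos.2 hd) : (0 : ℝ) < (d : ℝ) / 2)
  rw [← sub_div, show -(2 * α) + 1 = 1 - 2 * α by ring]
  field_simp

theorem calH_besselKernel_isBigO_of_gt {d : ℕ} {s α : ℝ} (hd : 0 < d) (hs : 0 < s)
    (hα : α < 1 / 2) (h1 : (d : ℝ) < s) (h2 : s < d + 2) :
    (fun t => (calH (spectralMeasure (besselKernel d s)) α t).toReal -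
        π ^ ((d : ℝ) / 2) * Gamma ((s - d) / 2) / ((1 - 2 * α) * Gamma (s / 2)) *
          t ^ (1 - 2 * α))
      =O[𝓝[>] 0] fun t => t ^ ((s - d) / 2 + 1 - 2 * α) := by
  have hint := setIntegral_rpow_mul_sub_isBigO_rpow (p := -(2 * α)) (measurable_kummer _ _)
    (by linarith) (eventually_mem_nhdsWithin.mono fun t ht =>
      hasIntegralOn_rpow_mul_const _ (by linarith) ht)
    (kummer_sub_isBigO_of_lt_add_one (half_pos (Nat.cast_pos.2 hd))
      (by linarith : (d : ℝ) / 2 < s / 2) (by linarith))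
  rw [show -(2 * α) + (s / 2 - (d : ℝ) / 2) + 1 = (s - d) / 2 + 1 - 2 * α by ring] at hint
  exact toReal_calH_besselKernel_sub_isBigO hd hs hint (calH_besselKernel_main_term_eq hd α)

theorem calH_besselKernel_isBigO_of_eq_add_two {d : ℕ} {s α : ℝ} (hd : 0 < d) (hs : 0 < s)
    (hα : α < 1 / 2) (h : s = d + 2) :
    (fun t => (calH (spectralMeasure (besselKernel d s)) α t).toReal -
        π ^ ((d : ℝ) / 2) / ((1 - 2 * α) * Gamma ((d : ℝ) / 2 + 1)) * t ^ (1 - 2 * α))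
      =O[𝓝[>] 0] fun t => t ^ (2 * (1 - α)) * log t := by
  have hK := kummer_add_one_sub_isBigO (a := (d : ℝ) / 2) (half_pos (Nat.cast_pos.2 hd))
  rw [show (d : ℝ) / 2 + 1 = s / 2 by rw [h]; ring] at hK ⊢
  have hint := setIntegral_rpow_mul_sub_isBigO_mul_log (p := -(2 * α)) (measurable_kummer _ _)
    (by linarith) (eventually_mem_nhdsWithin.mono fun t ht =>
      hasIntegralOn_rpow_mul_const _ (by linarith) ht) hK
  rw [show -(2 * α) + 2 = 2 * (1 - α) by ring] at hint
  refine toReal_calH_besselKernel_sub_isBigO hd hs hint fun t => ?_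
  rw [calH_besselKernel_main_term_eq hd, show (s - d) / 2 = 1 by rw [h]; ring, Gamma_one, mul_one]

theorem calH_besselKernel_isBigO_of_add_two_lt {d : ℕ} {s α : ℝ} (hd : 0 < d) (hs : 0 < s)
    (hα : α < 1 / 2) (h : (d : ℝ) + 2 < s) :
    (fun t => (calH (spectralMeasure (besselKernel d s)) α t).toReal -
        π ^ ((d : ℝ) / 2) * Gamma ((s - d) / 2) / ((1 - 2 * α) * Gamma (s / 2)) *
          t ^ (1 - 2 * α))
      =O[𝓝[>] 0] fun t => t ^ (2 * (1 - α)) := by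
  have hK := kummer_sub_isBigO_of_add_one_lt (a := (d : ℝ) / 2) (c := s / 2)
    (half_pos (Nat.cast_pos.2 hd)) (by linarith)
  have hint := setIntegral_rpow_mul_sub_isBigO_rpow (p := -(2 * α)) (e := 1)
    (measurable_kummer _ _) (by linarith) (eventually_mem_nhdsWithin.mono fun t ht =>
      hasIntegralOn_rpow_mul_const _ (by linarith) ht) (by simpa only [rpow_one] using hK)
  rw [show -(2 * α) + 1 + 1 = 2 * (1 - α) by ring] at hint
  exact toReal_calH_besselKernel_sub_isBigO hd hs hint (calH_besselKernel_main_term_eq hd α)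

end BesselNoise

open BesselNoise Real in
theorem proposition5p11_general (d : ℕ) (hd : 1 ≤ d) (s : ℝ) (hs : 0 < s) :
    (∀ α : ℝ, 0 < (d : ℝ) - 2 * (1 - α) → (d : ℝ) - 2 * (1 - α) < s →
      upsilon (spectralMeasure (besselKernel d s)) α 0 =
        ENNReal.ofReal (Gamma ((d : ℝ) / 2 - 1 + α) * Gamma ((s - d) / 2 + 1 - α) /
          (2 ^ d * π ^ ((d : ℝ) / 2) * Gamma ((d : ℝ) / 2) * Gamma (s / 2)))) ∧
    (0 < (d : ℝ) - 2 → (d : ℝ) - 2 < s →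
      upsilon (spectralMeasure (besselKernel d s)) 0 0 =
        ENNReal.ofReal (Gamma ((2 + s - d) / 2) /
          (2 ^ ((d : ℝ) - 1) * π ^ ((d : ℝ) / 2) * ((d : ℝ) - 2) * Gamma (s / 2)))) ∧
    (∀ α t : ℝ, 0 < t → (calH (spectralMeasure (besselKernel d s)) α t < ⊤ ↔
      α < 1 / 2 - max ((d : ℝ) - s) 0 / 4)) ∧
    (∀ α : ℝ, α < 1 / 2 →
      ((d : ℝ) - 2 < s → s < d → α < 1 / 2 - (d - s) / 4 →
        (fun t : ℝ => (calH (spectralMeasure (besselKernel d s)) α t).toReal -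
            (π ^ ((d : ℝ) / 2) * Gamma ((d - s) / 2) /
                (((s - d) / 2 + 1 - 2 * α) * Gamma ((d : ℝ) / 2)) *
                t ^ ((s - d) / 2 + 1 - 2 * α) +
              π ^ ((d : ℝ) / 2) * Gamma ((s - d) / 2) /
                ((1 - 2 * α) * Gamma (s / 2)) * t ^ (1 - 2 * α)))
          =O[𝓝[>] 0] fun t : ℝ => t ^ ((s - d) / 2 + 2 * (1 - α))) ∧
      (s = d →
        (fun t : ℝ => (calH (spectralMeasure (besselKernel d s)) α t).toReal -
            (π ^ ((d : ℝ) / 2) / ((1 - 2 * α) * Gamma ((d : ℝ) / 2)) *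
                t ^ (1 - 2 * α) * log (1 / t) +
              π ^ ((d : ℝ) / 2) *
                  (1 - (1 - 2 * α) * (digamma ((d : ℝ) / 2) + 2 * eulerMascheroniConstant)) /
                ((1 - 2 * α) ^ 2 * Gamma ((d : ℝ) / 2)) * t ^ (1 - 2 * α)))
          =O[𝓝[>] 0] fun t : ℝ => t ^ (2 * (1 - α)) * log t) ∧
      ((d : ℝ) < s → s < d + 2 →
        (fun t : ℝ => (calH (spectralMeasure (besselKernel d s)) α t).toReal -
            π ^ ((d : ℝ) / 2) * Gamma ((s - d) / 2) /
              ((1 - 2 * α) * Gamma (s / 2)) * t ^ (1 - 2 * α))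
          =O[𝓝[>] 0] fun t : ℝ => t ^ ((s - d) / 2 + 1 - 2 * α)) ∧
      (s = d + 2 →
        (fun t : ℝ => (calH (spectralMeasure (besselKernel d s)) α t).toReal -
            π ^ ((d : ℝ) / 2) / ((1 - 2 * α) * Gamma ((d : ℝ) / 2 + 1)) * t ^ (1 - 2 * α))
          =O[𝓝[>] 0] fun t : ℝ => t ^ (2 * (1 - α)) * log t) ∧
      ((d : ℝ) + 2 < s →
        (fun t : ℝ => (calH (spectralMeasure (besselKernel d s)) α t).toReal -
            π ^ ((d : ℝ) / 2) * Gamma ((s - d) / 2) /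
              ((1 - 2 * α) * Gamma (s / 2)) * t ^ (1 - 2 * α))
          =O[𝓝[>] 0] fun t : ℝ => t ^ (2 * (1 - α)))) :=
  ⟨fun _ => upsilon_besselKernel hd hs, upsilon_zero_besselKernel hs,
    fun α _ ht => calH_besselKernel_lt_top_iff hd hs ht α,
    fun _ hα => ⟨calH_besselKernel_isBigO_of_lt hd hs hα, calH_besselKernel_isBigO_of_eq hd hα,
      calH_besselKernel_isBigO_of_gt hd hs hα, calH_besselKernel_isBigO_of_eq_add_two hd hs hα,
      calH_besselKernel_isBigO_of_add_two_lt hd hs hα⟩⟩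

open BesselNoise in
theorem proposition5p11 (d : ℕ) (hd : 1 ≤ d) (s : ℝ) (hs : 0 < s) :
    -- value of `Υ_α(0)`
    (∀ α : ℝ, 0 < (d : ℝ) - 2 * (1 - α) → (d : ℝ) - 2 * (1 - α) < s →
      upsilon (spectralMeasure (besselKernel d s)) α 0 =
        ENNReal.ofReal
          (Real.Gamma ((d : ℝ) / 2 - 1 + α) * Real.Gamma ((s - d) / 2 + 1 - α) /
            (2 ^ d * Real.pi ^ ((d : ℝ) / 2) * Real.Gamma ((d : ℝ) / 2) * Real.Gamma (s / 2)))) ∧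
    -- the case `α = 0`
    (0 < (d : ℝ) - 2 → (d : ℝ) - 2 < s →
      upsilon (spectralMeasure (besselKernel d s)) 0 0 =
        ENNReal.ofReal
          (Real.Gamma ((2 + s - d) / 2) /
            (2 ^ ((d : ℝ) - 1) * Real.pi ^ ((d : ℝ) / 2) * ((d : ℝ) - 2) *
              Real.Gamma (s / 2)))) ∧
    -- finiteness of `𝓗_α`
    (∀ α : ℝ, 0 < α →
      ((∀ t : ℝ, 0 < t → calH (spectralMeasure (besselKernel d s)) α t < ⊤) ↔
        α < 1 / 2 - max ((d : ℝ) - s) 0 / 4 ∧ (d : ℝ) - 2 < s)) ∧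
    -- asymptotics of `𝓗_α(t)` as `t → 0+`
    (∀ α : ℝ, 0 < α → α < 1 / 2 →
      ((d : ℝ) - 2 < s → s < d → α < 1 / 2 - (d - s) / 4 →
        (fun t : ℝ => (calH (spectralMeasure (besselKernel d s)) α t).toReal -
            (Real.pi ^ ((d : ℝ) / 2) * Real.Gamma ((d - s) / 2) /
                (((s - d) / 2 + 1 - 2 * α) * Real.Gamma ((d : ℝ) / 2)) *
                t ^ ((s - d) / 2 + 1 - 2 * α) +
              Real.pi ^ ((d : ℝ) / 2) * Real.Gamma ((s - d) / 2) /
                ((1 - 2 * α) * Real.Gamma (s / 2)) * t ^ (1 - 2 * α)))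
          =O[𝓝[>] 0] fun t : ℝ => t ^ ((s - d) / 2 + 2 * (1 - α))) ∧
      (s = d →
        (fun t : ℝ => (calH (spectralMeasure (besselKernel d s)) α t).toReal -
            (Real.pi ^ ((d : ℝ) / 2) / ((1 - 2 * α) * Real.Gamma ((d : ℝ) / 2)) *
                t ^ (1 - 2 * α) * Real.log (1 / t) +
              Real.pi ^ ((d : ℝ) / 2) *
                  (1 - (1 - 2 * α) *
                    (digamma ((d : ℝ) / 2) + 2 * Real.eulerMascheroniConstant)) /
                ((1 - 2 * α) ^ 2 * Real.Gamma ((d : ℝ) / 2)) * t ^ (1 - 2 * α)))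
          =O[𝓝[>] 0] fun t : ℝ => t ^ (2 * (1 - α)) * Real.log t) ∧
      ((d : ℝ) < s → s < d + 2 →
        (fun t : ℝ => (calH (spectralMeasure (besselKernel d s)) α t).toReal -
            Real.pi ^ ((d : ℝ) / 2) * Real.Gamma ((s - d) / 2) /
              ((1 - 2 * α) * Real.Gamma (s / 2)) * t ^ (1 - 2 * α))
          =O[𝓝[>] 0] fun t : ℝ => t ^ ((s - d) / 2 + 1 - 2 * α)) ∧
      (s = d + 2 →
        (fun t : ℝ => (calH (spectralMeasure (besselKernel d s)) α t).toReal -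
            Real.pi ^ ((d : ℝ) / 2) /
              ((1 - 2 * α) * Real.Gamma ((d : ℝ) / 2 + 1)) * t ^ (1 - 2 * α))
          =O[𝓝[>] 0] fun t : ℝ => t ^ (2 * (1 - α)) * Real.log t) ∧
      ((d : ℝ) + 2 < s →
        (fun t : ℝ => (calH (spectralMeasure (besselKernel d s)) α t).toReal -
            Real.pi ^ ((d : ℝ) / 2) * Real.Gamma ((s - d) / 2) /
              ((1 - 2 * α) * Real.Gamma (s / 2)) * t ^ (1 - 2 * α))
          =O[𝓝[>] 0] fun t : ℝ => t ^ (2 * (1 - α)))) := by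
  obtain ⟨hupsilon, hupsilon_zero, hfinite, hasymptotic⟩ := proposition5p11_general d hd s hs
  refine ⟨hupsilon, hupsilon_zero, fun α hα => ⟨fun h => ?_, fun h t ht => (hfinite α t ht).2 h.1⟩,
    fun α _ => hasymptotic α⟩
  have hlt := (hfinite α 1 one_pos).1 (h 1 one_pos)
  exact ⟨hlt, by linarith [le_max_left ((d : ℝ) - s) 0]⟩
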